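/- Let $(\omega_z)_{z\in\mathbb Z^2}$ be independent rate $1$ exponentially distributed random variables. For $x,y\in\mathbb Z^2$ with $x\le y$ coordinatewise and $n=|y-x|_1$, let $\Pi_{x,y}$ be the set of up-right paths $(x_k)_{k=0}^{n}$ with $x_0=x$, $x_n=y$ and $x_{k+1}-x_k\in\{e_1,e_2\}$, and let $$G_{x,y}=\max_{(x_k)\in\Pi_{x,y}}\sum_{k=0}^{n}\omega_{x_k}.$$ Almost surely, for every $x\in\mathbb Z_{\ge 0}^2$ there is a unique path $\pi^{0,x}\in\Pi_{0,x}$ that attains the maximum $G_{0,x}$, called the geodesic from $0$ to $x$. For $x\neq 0$ let $$D_{0,x}=\max_{0\le i\le |x|_1}\Bigl|\,\pi^{0,x}_i-\frac{i}{|x|_1}\,x\,\Bigr|_1 .$$ Then $$\lim_{M\to\infty}\ \max_{x\in\mathbb Z_{\ge 0}^2:\ |x|_1=M}\ \frac{D_{0,x}}{|x|_1}=0\qquad\text{in probability.}$$ -/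

import Mathlib

open MeasureTheory ProbabilityTheory Filter Topology

namespace CornerGrowth

/-- The `ℓ¹` norm of a lattice point, as a natural number. -/
def l1 (x : ℤ × ℤ) : ℕ := x.1.natAbs + x.2.natAbs

/-- `p` is an up-right path from `x` to `y`: it starts at `x`, after `n = |y - x|₁` steps it is at
`y`, and each of these steps is `e₁ = (1, 0)` or `e₂ = (0, 1)`. Only the values `p 0, …, p n`
belong to the path; the values of the function `p` beyond the index `n` are irrelevant. -/
def IsUpRightPath (x y : ℤ × ℤ) (p : ℕ → ℤ × ℤ) : Prop :=
  p 0 = x ∧ p (l1 (y - x)) = y ∧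
    ∀ k < l1 (y - x), p (k + 1) - p k = (1, 0) ∨ p (k + 1) - p k = (0, 1)

/-- The weight collected by the path `p` from `x` to `y` in the environment `w`, both endpoints
included. -/
noncomputable def pathWeight (w : ℤ × ℤ → ℝ) (x y : ℤ × ℤ) (p : ℕ → ℤ × ℤ) : ℝ :=
  ∑ k ∈ Finset.range (l1 (y - x) + 1), w (p k)

/-- The last-passage time `G_{x,y}`: the maximal weight of an up-right path from `x` to `y`
(it is `-∞` if `x ≤ y` fails, as there is no path then). -/
noncomputable def lastPassage (w : ℤ × ℤ → ℝ) (x y : ℤ × ℤ) : EReal :=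
  ⨆ (p : ℕ → ℤ × ℤ) (_ : IsUpRightPath x y p), ((pathWeight w x y p : ℝ) : EReal)

/-- `p` is a geodesic (a maximizing path) for `G_{x,y}`. -/
def IsGeodesic (w : ℤ × ℤ → ℝ) (x y : ℤ × ℤ) (p : ℕ → ℤ × ℤ) : Prop :=
  IsUpRightPath x y p ∧ ((pathWeight w x y p : ℝ) : EReal) = lastPassage w x y

/-- The `ℓ¹` distance between the lattice point `p i` and the point
`((n - i) / n) x + (i / n) y` of the segment `[x, y]`, where `n = |y - x|₁`. -/
noncomputable def pointDeviation (x y : ℤ × ℤ) (p : ℕ → ℤ × ℤ) (i : ℕ) : ℝ :=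
  |((p i).1 : ℝ) - ((l1 (y - x) : ℝ) - i) / (l1 (y - x) : ℝ) * (x.1 : ℝ)
      - (i : ℝ) / (l1 (y - x) : ℝ) * (y.1 : ℝ)| +
  |((p i).2 : ℝ) - ((l1 (y - x) : ℝ) - i) / (l1 (y - x) : ℝ) * (x.2 : ℝ)
      - (i : ℝ) / (l1 (y - x) : ℝ) * (y.2 : ℝ)|

/-- The deviation `D_{x,y}` of the path `p` from the segment `[x, y]`: the maximum over
`0 ≤ i ≤ |y - x|₁` of the deviations of its points. -/
noncomputable def deviation (x y : ℤ × ℤ) (p : ℕ → ℤ × ℤ) : ℝ :=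
  (Finset.range (l1 (y - x) + 1)).sup' Finset.nonempty_range_add_one (pointDeviation x y p)

/-- The lattice points `x ≥ 0` with `|x|₁ = M`. -/
noncomputable def level (M : ℕ) : Finset (ℤ × ℤ) :=
  (Finset.Icc (0 : ℤ × ℤ) ((M : ℤ), (M : ℤ))).filter (fun x => l1 x = M)

theorem mem_level {M : ℕ} {x : ℤ × ℤ} : x ∈ level M ↔ 0 ≤ x ∧ l1 x = M := by
  simp only [level, Finset.mem_filter, Finset.mem_Icc]
  refine ⟨fun h => ⟨h.1.1, h.2⟩, fun h => ⟨⟨h.1, ?_⟩, h.2⟩⟩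
  obtain ⟨-, h2⟩ := h
  simp only [l1] at h2
  exact Prod.le_def.2 ⟨by simp only; omega, by simp only; omega⟩

theorem level_nonempty (M : ℕ) : (level M).Nonempty :=
  ⟨((M : ℤ), 0), mem_level.2 ⟨by simp [Prod.le_def], by simp [l1]⟩⟩

end CornerGrowth

/-! The last-passage time over a displacement (i, j) in a box of side N lies within εN of `shape i
j` = (√i + √j)², outside an event of exponentially small probability, uniformly in the endpoints. A
geodesic splits at each of its points, so the shape of the whole displacement exceeds the sum of the
shapes of the two pieces by at most a few such errors. Strict concavity of the shape
(`cross_sq_le_shape_gap`) bounds the squared deviation at that point by this gap times M/2, where M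
is the length. A union bound over polynomially many endpoints then treats all geodesics to a level
at once (`deviation_lt`, `tendsto_bad_event`).

The estimate for last-passage times comes from stationary models, with weights of rates a and b = 1
- a on the axes. The Burke property (`measurePreserving_burkeMap`) keeps the increments along every
row independent of rate a, so the stationary time at (m, n) concentrates at m/a + n/b. The minimum
of this over a is (√m + √n)².

Upper tail: the bulk time is at most the stationary time, and a nearly optimal a is used. Lower
tail: an optimal stationary path leaves an axis after some k and then runs in the bulk. Replacing
its axis piece by the neighbouring bulk row changes the mean by k/a - k = k b/a. At the nearly
optimal rate this excess is small, since otherwise the path would be too light (`exit_loss`,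
`exit_lower_bound`). -/

namespace CornerGrowth

/-! ### Deterministic last-passage recursion: superadditivity and exit from the axes. -/

section

/-- The last-passage time from `(0, 0)` to `(i, j)` in the quadrant environment `η`. -/
noncomputable def lpp (η : ℕ → ℕ → ℝ) : ℕ → ℕ → ℝ
  | 0, 0 => η 0 0
  | i + 1, 0 => lpp η i 0 + η (i + 1) 0
  | 0, j + 1 => lpp η 0 j + η 0 (j + 1)
  | i + 1, j + 1 => max (lpp η i (j + 1)) (lpp η (i + 1) j) + η (i + 1) (j + 1)
termination_by i j => i + j

theorem lpp_right (η : ℕ → ℕ → ℝ) (i j : ℕ) :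
    lpp η i j + η (i + 1) j ≤ lpp η (i + 1) j := by
  cases j with
  | zero => rw [lpp]
  | succ j => rw [lpp.eq_4]; gcongr; exact le_max_left _ _

theorem lpp_up (η : ℕ → ℕ → ℝ) (i j : ℕ) :
    lpp η i j + η i (j + 1) ≤ lpp η i (j + 1) := by
  cases i with
  | zero => rw [lpp.eq_3]
  | succ j => rw [lpp.eq_4]; gcongr; exact le_max_right _ _

theorem lpp_transpose (η : ℕ → ℕ → ℝ) (i j : ℕ) :
    lpp (fun a b => η b a) j i = lpp η i j := by
  induction j generalizing i with
  | zero =>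
    induction i with
    | zero => simp [lpp]
    | succ i ih => rw [lpp, lpp, ih]
  | succ j ihj =>
    induction i with
    | zero => rw [lpp, lpp, ihj]
    | succ i ih => rw [lpp, lpp, ih, ihj, max_comm]

theorem lpp_shift_right (η : ℕ → ℕ → ℝ) (i j : ℕ) :
    η 0 0 + lpp (fun a b => η (a + 1) b) i j ≤ lpp η (i + 1) j := by
  induction j generalizing i with
  | zero =>
    induction i with
    | zero => simp [lpp]
    | succ i ih =>
      rw [lpp, lpp, ← add_assoc]
      gcongr
  | succ j ihj =>
    induction i with
    | zero =>
      have := lpp_up η 1 j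
      have := ihj 0
      rw [lpp]
      simp only [zero_add] at *
      linarith
    | succ i ih =>
      rw [lpp, lpp.eq_4 η (i + 1), ← add_assoc, ← max_add_add_left]
      gcongr
      exact ihj _

theorem lpp_shift_up (η : ℕ → ℕ → ℝ) (i j : ℕ) :
    η 0 0 + lpp (fun a b => η a (b + 1)) i j ≤ lpp η i (j + 1) := by
  rw [← lpp_transpose η, ← lpp_transpose (fun a b => η a (b + 1))]
  exact lpp_shift_right (fun a b => η b a) j i

/-- Paths from (1, 1) are prolonged to the corner through (1, 0), which adds two nonnegative
weights. This compares the bulk with the stationary model. -/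
theorem lpp_shift_diag {η : ℕ → ℕ → ℝ} (hη : ∀ i j, 0 ≤ η i j) (i j : ℕ) :
    lpp (fun a b => η (a + 1) (b + 1)) i j ≤ lpp η (i + 1) (j + 1) := by
  have h1 := lpp_shift_up (fun a b => η (a + 1) b) i j
  have h2 := lpp_shift_right η i (j + 1)
  linarith [hη 0 0, hη (0 + 1) 0]

/-- One may walk k steps along the axis before following an optimal path. In the lower tail this
turns an exit from the axis into a competitor in the bulk. -/
theorem sum_add_lpp_le (η : ℕ → ℕ → ℝ) (k i j : ℕ) :
    ∑ t ∈ Finset.range k, η t 0 + lpp (fun a b => η (k + a) b) i j ≤ lpp η (k + i) j := by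
  induction k generalizing η with
  | zero => simp
  | succ k ih =>
    have h1 := ih (fun a b => η (a + 1) b)
    have h2 := lpp_shift_right η (k + i) j
    rw [Finset.sum_range_succ']
    have h3 : k + 1 + i = k + i + 1 := by ring
    have h4 : (fun a b => η (k + 1 + a) b) = fun a b => η (k + a + 1) b := by
      funext a b; congr 1; ring
    rw [h3, h4]
    linarith

/-- A path from the corner with zero weight leaves the two axes either at a point `(k + 1, 0)`
or at a point `(0, k + 1)`. -/
theorem lpp_exit {η : ℕ → ℕ → ℝ} (h0 : η 0 0 = 0) (i j : ℕ) :
    (∃ k ≤ i, lpp η (i + 1) (j + 1) ≤ ∑ t ∈ Finset.range (k + 1), η (t + 1) 0 +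
      lpp (fun a b => η (k + a + 1) (b + 1)) (i - k) j) ∨
    (∃ k ≤ j, lpp η (i + 1) (j + 1) ≤ ∑ t ∈ Finset.range (k + 1), η 0 (t + 1) +
      lpp (fun a b => η (a + 1) (k + b + 1)) i (j - k)) := by
  have hrow : ∀ i, lpp η i 0 = ∑ t ∈ Finset.range i, η (t + 1) 0 := by
    intro i
    induction i with
    | zero => simp [lpp, h0]
    | succ i ih => rw [lpp, ih, Finset.sum_range_succ]
  have hcol : ∀ j, lpp η 0 j = ∑ t ∈ Finset.range j, η 0 (t + 1) := by
    intro i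
    induction i with
    | zero => simp [lpp, h0]
    | succ i ih => rw [lpp, ih, Finset.sum_range_succ]
  -- When the maximum is attained at the left neighbour, its exit is inherited. If i = 0 this
  -- neighbour lies on the vertical axis, and the exit is at (0, j + 1) itself.
  have hl : ∀ i j, lpp η (i + 1) (j + 1) = lpp η i (j + 1) + η (i + 1) (j + 1) →
      ((∃ k < i, lpp η i (j + 1) ≤ ∑ t ∈ Finset.range (k + 1), η (t + 1) 0 +
        lpp (fun a b => η (k + a + 1) (b + 1)) (i - 1 - k) j) ∨
      (i ≠ 0 ∧ ∃ k ≤ j, lpp η i (j + 1) ≤ ∑ t ∈ Finset.range (k + 1), η 0 (t + 1) +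
        lpp (fun a b => η (a + 1) (k + b + 1)) (i - 1) (j - k)) ∨ i = 0) →
      (∃ k ≤ i, lpp η (i + 1) (j + 1) ≤ ∑ t ∈ Finset.range (k + 1), η (t + 1) 0 +
      lpp (fun a b => η (k + a + 1) (b + 1)) (i - k) j) ∨
    (∃ k ≤ j, lpp η (i + 1) (j + 1) ≤ ∑ t ∈ Finset.range (k + 1), η 0 (t + 1) +
      lpp (fun a b => η (a + 1) (k + b + 1)) i (j - k)) := by
    intro i j he h
    rcases h with ⟨k, hk, h⟩ | ⟨hi, k, hk, h⟩ | rfl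
    · refine .inl ⟨k, hk.le, ?_⟩
      have := lpp_right (fun a b => η (k + a + 1) (b + 1)) (i - 1 - k) j
      have e1 : i - 1 - k + 1 = i - k := by omega
      have e2 : k + (i - k) + 1 = i + 1 := by omega
      simp only [e1, e2] at this
      linarith
    · refine .inr ⟨k, hk, ?_⟩
      have := lpp_right (fun a b => η (a + 1) (k + b + 1)) (i - 1) (j - k)
      have e1 : i - 1 + 1 = i := by omega
      have e2 : k + (j - k) + 1 = j + 1 := by omega
      simp only [e1, e2] at this
      linarith
    · refine .inr ⟨j, le_rfl, ?_⟩
      rw [he, hcol]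
      simp [lpp]
  have hd : ∀ i j, lpp η (i + 1) (j + 1) = lpp η (i + 1) j + η (i + 1) (j + 1) →
      ((j ≠ 0 ∧ ∃ k ≤ i, lpp η (i + 1) j ≤ ∑ t ∈ Finset.range (k + 1), η (t + 1) 0 +
        lpp (fun a b => η (k + a + 1) (b + 1)) (i - k) (j - 1)) ∨
      (∃ k < j, lpp η (i + 1) j ≤ ∑ t ∈ Finset.range (k + 1), η 0 (t + 1) +
        lpp (fun a b => η (a + 1) (k + b + 1)) i (j - 1 - k)) ∨ j = 0) →
      (∃ k ≤ i, lpp η (i + 1) (j + 1) ≤ ∑ t ∈ Finset.range (k + 1), η (t + 1) 0 +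
      lpp (fun a b => η (k + a + 1) (b + 1)) (i - k) j) ∨
    (∃ k ≤ j, lpp η (i + 1) (j + 1) ≤ ∑ t ∈ Finset.range (k + 1), η 0 (t + 1) +
      lpp (fun a b => η (a + 1) (k + b + 1)) i (j - k)) := by
    intro i j he h
    rcases h with ⟨hi, k, hk, h⟩ | ⟨k, hk, h⟩ | rfl
    · refine .inl ⟨k, hk, ?_⟩
      have := lpp_up (fun a b => η (k + a + 1) (b + 1)) (i - k) (j - 1)
      have e1 : j - 1 + 1 = j := by omega
      have e2 : k + (i - k) + 1 = i + 1 := by omega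
      simp only [e1, e2] at this
      linarith
    · refine .inr ⟨k, hk.le, ?_⟩
      have := lpp_up (fun a b => η (a + 1) (k + b + 1)) i (j - 1 - k)
      have e1 : j - 1 - k + 1 = j - k := by omega
      have e2 : k + (j - k) + 1 = j + 1 := by omega
      simp only [e1, e2] at this
      linarith
    · refine .inl ⟨i, le_rfl, ?_⟩
      rw [he, hrow]
      simp [lpp]
  induction j generalizing i with
  | zero =>
    induction i with
    | zero =>
      rcases max_choice (lpp η 0 (0 + 1)) (lpp η (0 + 1) 0) with h | h
      · exact hl 0 0 (by rw [lpp.eq_4, h]) (by simp)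
      · exact hd 0 0 (by rw [lpp.eq_4, h]) (by simp)
    | succ i ih =>
      rcases max_choice (lpp η (i + 1) (0 + 1)) (lpp η (i + 1 + 1) 0) with h | h
      · refine hl _ _ (by rw [lpp.eq_4, h]) ?_
        rcases ih with ⟨k, hk, h⟩ | ⟨k, hk, h⟩
        · exact .inl ⟨k, by omega, h⟩
        · exact .inr (.inl ⟨by omega, k, hk, h⟩)
      · exact hd _ _ (by rw [lpp.eq_4, h]) (by simp)
  | succ j ihj =>
    induction i with
    | zero =>
      rcases max_choice (lpp η 0 (j + 1 + 1)) (lpp η (0 + 1) (j + 1)) with h | h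
      · exact hl _ _ (by rw [lpp.eq_4, h]) (by simp)
      · refine hd _ _ (by rw [lpp.eq_4, h]) ?_
        rcases ihj 0 with ⟨k, hk, h⟩ | ⟨k, hk, h⟩
        · exact .inl ⟨by omega, k, hk, h⟩
        · exact .inr (.inl ⟨k, by omega, h⟩)
    | succ i ih =>
      rcases max_choice (lpp η (i + 1) (j + 1 + 1)) (lpp η (i + 1 + 1) (j + 1)) with h | h
      · refine hl _ _ (by rw [lpp.eq_4, h]) ?_
        rcases ih with ⟨k, hk, h⟩ | ⟨k, hk, h⟩
        · exact .inl ⟨k, by omega, h⟩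
        · exact .inr (.inl ⟨by omega, k, hk, h⟩)
      · refine hd _ _ (by rw [lpp.eq_4, h]) ?_
        rcases ihj (i + 1) with ⟨k, hk, h⟩ | ⟨k, hk, h⟩
        · exact .inl ⟨by omega, k, hk, h⟩
        · exact .inr (.inl ⟨k, by omega, h⟩)

end

/-! ### Exponential laws and Chernoff bounds. -/

section

theorem lintegral_expMeasure (r : ℝ) {f : ℝ → ENNReal} (hf : Measurable f) :
    ∫⁻ x, f x ∂(expMeasure r) = ∫⁻ x, exponentialPDF r x * f x := by
  have hm : Measurable (exponentialPDF r) :=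
    (measurable_exponentialPDFReal r).ennreal_ofReal
  exact lintegral_withDensity_eq_lintegral_mul volume hm hf

theorem nullSingletonClass_expMeasure (r : ℝ) : NullSingletonClass (expMeasure r) :=
  inferInstanceAs (NullSingletonClass ((volume : Measure ℝ).withDensity (exponentialPDF r)))

theorem hasLaw_const_mul_exp {Ω : Type*} [MeasurableSpace Ω] {P : Measure Ω} {X : Ω → ℝ}
    {r c : ℝ} (hr : 0 < r) (hc : 0 < c) (hX : HasLaw X (expMeasure r) P) :
    HasLaw (fun ω => c * X ω) (expMeasure (r / c)) P := by
  have hrc : 0 < r / c := div_pos hr hc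
  have := isProbabilityMeasure_expMeasure hr
  have := isProbabilityMeasure_expMeasure hrc
  refine HasLaw.fun_comp (μ := expMeasure r) (Y := fun x => c * x) ⟨by fun_prop, ?_⟩ hX
  have hp : IsProbabilityMeasure ((expMeasure r).map fun x => c * x) :=
    Measure.isProbabilityMeasure_map (by fun_prop)
  refine Measure.eq_of_cdf _ _ ?_
  ext x
  rw [cdf_expMeasure_eq hrc, cdf_eq_real, measureReal_def,
    Measure.map_apply (by fun_prop) measurableSet_Iic]
  have hpre : (fun x => c * x) ⁻¹' Set.Iic x = Set.Iic (x / c) := by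
    ext y
    simp only [Set.mem_preimage, Set.mem_Iic]
    rw [le_div_iff₀ hc, mul_comm]
  rw [hpre, ← measureReal_def, ← cdf_eq_real, cdf_expMeasure_eq hr]
  have : (0 ≤ x / c) ↔ 0 ≤ x := by rw [le_div_iff₀ hc, zero_mul]
  have he : r * (x / c) = r / c * x := by ring
  simp only [this, he]

theorem ae_nonneg_of_hasLaw_exp {Ω : Type*} [MeasurableSpace Ω] {P : Measure Ω} {X : Ω → ℝ}
    {r : ℝ} (hX : HasLaw X (expMeasure r) P) : ∀ᵐ ω ∂P, 0 ≤ X ω := by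
  have h : ∀ᵐ x ∂(expMeasure r), 0 ≤ x := by
    have h1 : expMeasure r {x | ¬ 0 ≤ x} = 0 := by
      have : expMeasure r (Set.Iio 0) = ∫⁻ x in Set.Iio 0, exponentialPDF r x :=
        withDensity_apply _ measurableSet_Iio
      rw [lintegral_exponentialPDF_of_nonpos le_rfl] at this
      convert this using 2
      ext x; simp
    exact h1
  rw [← hX.map_eq] at h
  exact ae_of_ae_map hX.aemeasurable h

/-- Exponential tilting: e^(θx) times the density of rate 1 is a multiple of the density of rate 1 -
θ. -/
theorem lintegral_exp_mul_expMeasure {θ : ℝ} (hθ : θ < 1) :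
    ∫⁻ x, ENNReal.ofReal (Real.exp (θ * x)) ∂(expMeasure 1) = ENNReal.ofReal (1 / (1 - θ)) := by
  have h1 : 0 < 1 - θ := by linarith
  rw [lintegral_expMeasure _ (by fun_prop)]
  have h : ∀ x, exponentialPDF 1 x * ENNReal.ofReal (Real.exp (θ * x)) =
      ENNReal.ofReal (1 / (1 - θ)) * exponentialPDF (1 - θ) x := by
    intro x
    rw [exponentialPDF_eq, exponentialPDF_eq, ← ENNReal.ofReal_mul (by split_ifs <;> positivity),
      ← ENNReal.ofReal_mul (by positivity)]
    congr 1
    split_ifs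
    · have he : Real.exp (-((1 - θ) * x)) = Real.exp (-(1 * x)) * Real.exp (θ * x) := by
        rw [← Real.exp_add]
        congr 1
        ring
      rw [he]
      field_simp
    · simp
  simp_rw [h]
  rw [lintegral_const_mul (μ := volume) (f := exponentialPDF (1 - θ)) _
    (measurable_exponentialPDFReal _).ennreal_ofReal, lintegral_exponentialPDF_eq_one h1, mul_one]

theorem mgf_of_hasLaw_exp {Ω : Type*} [MeasurableSpace Ω] {P : Measure Ω} {X : Ω → ℝ}
    (hX : HasLaw X (expMeasure 1) P) {θ : ℝ} (hθ : θ < 1) :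
    mgf X P θ = 1 / (1 - θ) := by
  have h1 : 0 < 1 - θ := by linarith
  rw [← mgf_id_map hX.aemeasurable, hX.map_eq, mgf]
  rw [integral_eq_lintegral_of_nonneg_ae (ae_of_all _ fun _ => (Real.exp_pos _).le) (by fun_prop)]
  simp only [id_eq]
  rw [lintegral_exp_mul_expMeasure hθ, ENNReal.toReal_ofReal (by positivity)]

section Chernoff

variable {Ω ι : Type*} [MeasurableSpace Ω] {P : Measure Ω} {X : ι → Ω → ℝ}

/-- The quadratic term carries the box size N instead of the number of summands, so that later
bounds are uniform over short and long sums. -/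
theorem mgf_sum_le (hind : iIndepFun X P) (hlaw : ∀ i, HasLaw (X i) (expMeasure 1) P)
    (s : Finset ι) {N : ℕ} (hs : s.card ≤ N) {θ : ℝ} (hθ : |θ| ≤ 1 / 2) :
    mgf (∑ i ∈ s, X i) P θ ≤ Real.exp (θ * s.card + θ ^ 2 * N) := by
  obtain ⟨hθ1, hθ2⟩ := abs_le.1 hθ
  rw [hind.mgf_sum₀ (fun i => (hlaw i).aemeasurable)]
  rw [Finset.prod_congr rfl fun i _ => mgf_of_hasLaw_exp (hlaw i) (by linarith : θ < 1)]
  rw [Finset.prod_const]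
  have h1 : 1 / (1 - θ) ≤ Real.exp (θ + θ ^ 2) := by
    have h2 : 0 < 1 - θ := by linarith
    rw [div_le_iff₀ h2]
    have h5 : 1 + (θ + θ ^ 2) ≤ Real.exp (θ + θ ^ 2) := by
      linarith [Real.add_one_le_exp (θ + θ ^ 2)]
    -- (1 + θ + θ²)(1 - θ) = 1 - θ³, so the linear bound on exp suffices only for θ < 0; for θ ≥ 0
    -- its quadratic term is needed.
    by_cases h : 0 ≤ θ
    · have h6 := Real.quadratic_le_exp_of_nonneg (x := θ + θ ^ 2) (by positivity)
      have : 1 ≤ (1 + (θ + θ ^ 2) + (θ + θ ^ 2) ^ 2 / 2) * (1 - θ) := by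
        have : (1 + (θ + θ ^ 2) + (θ + θ ^ 2) ^ 2 / 2) * (1 - θ) - 1 =
          θ ^ 2 / 2 * ((1 - θ) * (1 + θ) ^ 2 - 2 * θ) := by ring
        have h8 : 0 ≤ (1 - θ) * (1 + θ) ^ 2 - 2 * θ := by nlinarith [sq_nonneg θ]
        have : 0 ≤ θ ^ 2 / 2 * ((1 - θ) * (1 + θ) ^ 2 - 2 * θ) := by positivity
        linarith
      nlinarith
    · push Not at h
      have : 1 ≤ (1 + (θ + θ ^ 2)) * (1 - θ) := by
        have : (1 + (θ + θ ^ 2)) * (1 - θ) - 1 = θ ^ 2 * (-θ) := by ring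
        have : 0 ≤ θ ^ 2 * (-θ) := mul_nonneg (sq_nonneg _) (by linarith)
        linarith
      nlinarith
  have h0 : 0 ≤ 1 / (1 - θ) := by
    have h2 : 0 < 1 - θ := by linarith
    positivity
  calc (1 / (1 - θ)) ^ s.card ≤ Real.exp (θ + θ ^ 2) ^ s.card := by gcongr
    _ = Real.exp (θ * s.card + θ ^ 2 * s.card) := by rw [← Real.exp_nat_mul]; congr 1; ring
    _ ≤ _ := by gcongr

theorem integrable_exp_mul_sum (hind : iIndepFun X P)
    (hlaw : ∀ i, HasLaw (X i) (expMeasure 1) P) (s : Finset ι) {θ : ℝ} (hθ : θ < 1) :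
    Integrable (fun ω => Real.exp (θ * (∑ i ∈ s, X i) ω)) P := by
  -- Without integrability `mgf` takes the default value 0, whereas the product formula gives a
  -- positive value.
  by_contra h
  have h1 := mgf_undef h
  rw [hind.mgf_sum₀ (fun i => (hlaw i).aemeasurable),
    Finset.prod_congr rfl fun i _ => mgf_of_hasLaw_exp (hlaw i) hθ, Finset.prod_const] at h1
  have h2 : 0 < 1 - θ := by linarith
  exact (pow_pos (one_div_pos.2 h2) _).ne' h1

variable [IsProbabilityMeasure P]

/-- The choice θ = ε/2 minimizes -θεN + θ²N. -/
theorem sum_upper_tail (hind : iIndepFun X P) (hlaw : ∀ i, HasLaw (X i) (expMeasure 1) P)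
    (s : Finset ι) {N : ℕ} (hs : s.card ≤ N) {ε : ℝ} (h0 : 0 ≤ ε) (h1 : ε ≤ 1) :
    P.real {ω | s.card + ε * N ≤ ∑ i ∈ s, X i ω} ≤ Real.exp (-(ε ^ 2 / 4 * N)) := by
  have hint := integrable_exp_mul_sum hind hlaw s (θ := ε / 2) (by linarith)
  have h := measure_ge_le_exp_mul_mgf (μ := P) (X := ∑ i ∈ s, X i) (t := ε / 2)
    (s.card + ε * N) (by positivity) hint
  simp only [Finset.sum_apply] at h
  refine h.trans ?_
  have hm := mgf_sum_le hind hlaw s hs (θ := ε / 2) (by rw [abs_le]; constructor <;> linarith)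
  calc _ ≤ Real.exp (-(ε / 2) * (s.card + ε * N)) *
        Real.exp (ε / 2 * s.card + (ε / 2) ^ 2 * N) := by gcongr
    _ = _ := by rw [← Real.exp_add]; congr 1; ring

theorem sum_lower_tail (hind : iIndepFun X P) (hlaw : ∀ i, HasLaw (X i) (expMeasure 1) P)
    (s : Finset ι) {N : ℕ} (hs : s.card ≤ N) {ε : ℝ} (h0 : 0 ≤ ε) (h1 : ε ≤ 1) :
    P.real {ω | ∑ i ∈ s, X i ω ≤ s.card - ε * N} ≤ Real.exp (-(ε ^ 2 / 4 * N)) := by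
  have hint := integrable_exp_mul_sum hind hlaw s (θ := -(ε / 2)) (by linarith)
  have h := measure_le_le_exp_mul_mgf (μ := P) (X := ∑ i ∈ s, X i) (t := -(ε / 2))
    (s.card - ε * N) (by linarith) hint
  simp only [Finset.sum_apply] at h
  refine h.trans ?_
  have hm := mgf_sum_le hind hlaw s hs (θ := -(ε / 2)) (by rw [abs_le]; constructor <;> linarith)
  calc _ ≤ Real.exp (-(-(ε / 2)) * (s.card - ε * N)) *
        Real.exp (-(ε / 2) * s.card + (-(ε / 2)) ^ 2 * N) := by gcongr
    _ = _ := by rw [← Real.exp_add]; congr 1; ring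

end Chernoff

end

/-! ### The Burke property of a corner. -/

section

/-- The update of the horizontal increment, the vertical increment and the weight at a corner
of the growth process; the third component is the dual weight. -/
noncomputable def burkeMap (z : ℝ × ℝ × ℝ) : ℝ × ℝ × ℝ :=
  (z.2.2 + max (z.1 - z.2.1) 0, z.2.2 + max (z.2.1 - z.1) 0, min z.1 z.2.1)

theorem measurable_burkeMap : Measurable burkeMap := by
  unfold burkeMap
  fun_prop

theorem measurable_exponentialPDF (r : ℝ) : Measurable (exponentialPDF r) :=
  (measurable_exponentialPDFReal r).ennreal_ofReal

/-- The difference r = u - v of the two increments is taken as a coordinate because `burkeMap`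
leaves it invariant. -/
theorem lintegral_prod_expMeasure {a b c : ℝ} (ha : 0 < a) (hb : 0 < b) (hc : 0 < c)
    {F : ℝ × ℝ × ℝ → ENNReal} (hF : Measurable F) :
    ∫⁻ z, F z ∂((expMeasure a).prod ((expMeasure b).prod (expMeasure c))) =
      ∫⁻ r, ∫⁻ v, ∫⁻ t, exponentialPDF a (v + r) * exponentialPDF b v * exponentialPDF c t *
        F (v + r, v, t) := by
  have := isProbabilityMeasure_expMeasure ha
  have := isProbabilityMeasure_expMeasure hb
  have := isProbabilityMeasure_expMeasure hc
  have ma := measurable_exponentialPDF a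
  have mb := measurable_exponentialPDF b
  have mc := measurable_exponentialPDF c
  have h1 : ∫⁻ z, F z ∂((expMeasure a).prod ((expMeasure b).prod (expMeasure c))) =
      ∫⁻ u, ∫⁻ v, ∫⁻ t, exponentialPDF a u * exponentialPDF b v * exponentialPDF c t *
        F (u, v, t) := by
    rw [lintegral_prod _ hF.aemeasurable, lintegral_expMeasure a (Measurable.lintegral_prod_right' hF)]
    congr 1 with u
    have hFu : Measurable fun y : ℝ × ℝ => F (u, y) := by fun_prop
    rw [lintegral_prod _ hFu.aemeasurable, lintegral_expMeasure b (Measurable.lintegral_prod_right' hFu),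
      ← lintegral_const_mul _ (by
        refine mb.mul (Measurable.lintegral_prod_right' hFu))]
    congr 1 with v
    have hFv : Measurable fun t : ℝ => F (u, v, t) := by fun_prop
    rw [lintegral_expMeasure c hFv, ← mul_assoc, ← lintegral_const_mul _ (by fun_prop)]
    congr 1 with t
    ring
  rw [h1, lintegral_lintegral_swap]
  · have h2 : ∀ v, ∫⁻ u, ∫⁻ t, exponentialPDF a u * exponentialPDF b v * exponentialPDF c t *
        F (u, v, t) = ∫⁻ r, ∫⁻ t, exponentialPDF a (v + r) * exponentialPDF b v *
        exponentialPDF c t * F (v + r, v, t) := fun v =>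
      (lintegral_add_left_eq_self (μ := volume) (fun u => ∫⁻ t, exponentialPDF a u *
        exponentialPDF b v * exponentialPDF c t * F (u, v, t)) v).symm
    simp_rw [h2]
    rw [lintegral_lintegral_swap]
    refine Measurable.aemeasurable ?_
    have hm : Measurable fun z : (ℝ × ℝ) × ℝ => exponentialPDF a (z.1.1 + z.1.2) *
        exponentialPDF b z.1.1 * exponentialPDF c z.2 * F (z.1.1 + z.1.2, z.1.1, z.2) := by
      fun_prop
    exact Measurable.lintegral_prod_right' hm
  · refine Measurable.aemeasurable ?_
    have hm : Measurable fun z : (ℝ × ℝ) × ℝ => exponentialPDF a z.1.1 *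
        exponentialPDF b z.1.2 * exponentialPDF c z.2 * F (z.1.1, z.1.2, z.2) := by
      fun_prop
    exact Measurable.lintegral_prod_right' hm

/-- Since a + b = 1, the exponent is -(ar + v + t), symmetric in v and t. For r ≥ 0 the minimum of
the increments is v, and `burkeMap` merely exchanges v and t. -/
theorem exponentialPDF_burke_of_nonneg {a b : ℝ} (ha : 0 < a) (hb : 0 < b) (hab : a + b = 1)
    {r : ℝ} (hr : 0 ≤ r) (v t : ℝ) :
    exponentialPDF a (v + r) * exponentialPDF b v * exponentialPDF 1 t =
      exponentialPDF a (t + r) * exponentialPDF b t * exponentialPDF 1 v := by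
  by_cases hv : 0 ≤ v
  · by_cases ht : 0 ≤ t
    · rw [exponentialPDF_of_nonneg hv, exponentialPDF_of_nonneg ht,
        exponentialPDF_of_nonneg hv, exponentialPDF_of_nonneg ht,
        exponentialPDF_of_nonneg (add_nonneg hv hr), exponentialPDF_of_nonneg (add_nonneg ht hr),
        ← ENNReal.ofReal_mul (by positivity), ← ENNReal.ofReal_mul (by positivity),
        ← ENNReal.ofReal_mul (by positivity), ← ENNReal.ofReal_mul (by positivity)]
      have he : Real.exp (-(a * (v + r))) * Real.exp (-(b * v)) * Real.exp (-(1 * t)) =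
          Real.exp (-(a * (t + r))) * Real.exp (-(b * t)) * Real.exp (-(1 * v)) := by
        simp only [← Real.exp_add]
        congr 1
        obtain rfl : b = 1 - a := by linarith
        ring
      congr 1
      linear_combination a * b * he
    · push Not at ht
      simp [exponentialPDF_of_neg ht]
  · push Not at hv
    simp [exponentialPDF_of_neg hv]

/-- For r < 0 the minimum is v + r, and `burkeMap` sends (v, t) to (t - r, v + r); the exponent is
again unchanged. -/
theorem exponentialPDF_burke_of_neg {a b : ℝ} (ha : 0 < a) (hb : 0 < b) (hab : a + b = 1)
    {r : ℝ} (hr : r < 0) (v t : ℝ) :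
    exponentialPDF a (v + r) * exponentialPDF b v * exponentialPDF 1 t =
      exponentialPDF a t * exponentialPDF b (t - r) * exponentialPDF 1 (v + r) := by
  by_cases hv : 0 ≤ v + r
  · by_cases ht : 0 ≤ t
    · have hv' : 0 ≤ v := by linarith
      have ht' : 0 ≤ t - r := by linarith
      rw [exponentialPDF_of_nonneg hv, exponentialPDF_of_nonneg ht,
        exponentialPDF_of_nonneg hv, exponentialPDF_of_nonneg ht,
        exponentialPDF_of_nonneg hv', exponentialPDF_of_nonneg ht',
        ← ENNReal.ofReal_mul (by positivity), ← ENNReal.ofReal_mul (by positivity),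
        ← ENNReal.ofReal_mul (by positivity), ← ENNReal.ofReal_mul (by positivity)]
      have he : Real.exp (-(a * (v + r))) * Real.exp (-(b * v)) * Real.exp (-(1 * t)) =
          Real.exp (-(a * t)) * Real.exp (-(b * (t - r))) * Real.exp (-(1 * (v + r))) := by
        simp only [← Real.exp_add]
        congr 1
        obtain rfl : b = 1 - a := by linarith
        ring
      congr 1
      linear_combination a * b * he
    · push Not at ht
      simp [exponentialPDF_of_neg ht]
  · push Not at hv
    simp [exponentialPDF_of_neg hv]

/-- The Burke property at one corner. -/
theorem measurePreserving_burkeMap {a b : ℝ} (ha : 0 < a) (hb : 0 < b) (hab : a + b = 1) :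
    MeasurePreserving burkeMap ((expMeasure a).prod ((expMeasure b).prod (expMeasure 1)))
      ((expMeasure a).prod ((expMeasure b).prod (expMeasure 1))) := by
  refine ⟨measurable_burkeMap, ?_⟩
  have ma := measurable_exponentialPDF a
  have mb := measurable_exponentialPDF b
  have mc := measurable_exponentialPDF 1
  refine Measure.ext_of_lintegral _ fun F hF => ?_
  rw [lintegral_map hF measurable_burkeMap,
    lintegral_prod_expMeasure (F := fun z => F (burkeMap z)) ha hb one_pos
      (hF.comp measurable_burkeMap),
    lintegral_prod_expMeasure ha hb one_pos hF]
  congr 1 with r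
  rcases le_or_gt 0 r with hr | hr
  · rw [lintegral_lintegral_swap]
    · congr 1 with t
      congr 1 with v
      rw [exponentialPDF_burke_of_nonneg ha hb hab hr]
      congr 2
      simp [burkeMap, hr]
    · have := measurable_burkeMap
      refine Measurable.aemeasurable ?_
      unfold Function.uncurry
      fun_prop
  -- At fixed r < 0 the map is an exchange of v and t followed by two translations, which preserve
  -- Lebesgue measure.
  · have h1 : ∀ f : ℝ → ENNReal, ∫⁻ y, f y = ∫⁻ t, f (t - r) := fun f =>
      (lintegral_sub_right_eq_self (μ := volume) f r).symm
    have h2 : ∀ f : ℝ → ENNReal, ∫⁻ y, f y = ∫⁻ t, f (t + r) := fun f =>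
      (lintegral_add_right_eq_self (μ := volume) f r).symm
    rw [lintegral_lintegral_swap]
    · conv_rhs => rw [h1]
      congr 1 with t
      conv_rhs => rw [h2]
      congr 1 with v
      rw [exponentialPDF_burke_of_neg ha hb hab hr, sub_add_cancel]
      congr 2
      simp [burkeMap, hr.le, sub_eq_add_neg]
    · have := measurable_burkeMap
      refine Measurable.aemeasurable ?_
      unfold Function.uncurry
      fun_prop

variable {Ω ι : Type*} [MeasurableSpace Ω] {P : Measure Ω} [IsProbabilityMeasure P]

theorem hasLaw_prodMk {E F : Type*} [MeasurableSpace E] [MeasurableSpace F] {X : Ω → E}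
    {Y : Ω → F} {μ : Measure E} {ν : Measure F} (hX : HasLaw X μ P) (hY : HasLaw Y ν P)
    (h : IndepFun X Y P) : HasLaw (fun ω => (X ω, Y ω)) (μ.prod ν) P where
  aemeasurable := hX.aemeasurable.prodMk hY.aemeasurable
  map_eq := by
    rw [(indepFun_iff_map_prod_eq_prod_map_map hX.aemeasurable hY.aemeasurable).1 h, hX.map_eq,
      hY.map_eq]

/-- Updating three members of an independent exponential family by the map of a corner gives
an independent family with the same laws. -/
theorem exists_burke_update {X : ι → Ω → ℝ} (hX : iIndepFun X P)
    {c : ι → ℝ} (hc : ∀ i, 0 < c i) (hlaw : ∀ i, HasLaw (X i) (expMeasure (c i)) P)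
    {p q r : ι} (hpq : p ≠ q) (hpr : p ≠ r) (hqr : q ≠ r) (hr : c r = 1)
    (hab : c p + c q = 1) :
    ∃ Y : ι → Ω → ℝ, iIndepFun Y P ∧ (∀ i, HasLaw (Y i) (expMeasure (c i)) P) ∧
      (Y p = fun ω => X r ω + max (X p ω - X q ω) 0) ∧
      (Y q = fun ω => X r ω + max (X q ω - X p ω) 0) ∧
      ∀ i, i ≠ p → i ≠ q → i ≠ r → Y i = X i := by
  classical
  have hm : ∀ i, AEMeasurable (X i) P := fun i => (hlaw i).aemeasurable
  let Z : Ω → ℝ × ℝ × ℝ := fun ω => burkeMap (X p ω, X q ω, X r ω)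
  have hZ0 : HasLaw (fun ω => (X p ω, X q ω, X r ω))
      ((expMeasure (c p)).prod ((expMeasure (c q)).prod (expMeasure 1))) P := by
    have h1 := hasLaw_prodMk (hlaw q) (hlaw r) (hX.indepFun hqr)
    have h2 := hasLaw_prodMk (hlaw p) h1
      (hX.indepFun_prodMk₀ hm q r p hpq.symm hpr.symm).symm
    rwa [hr] at h2
  have hZ : HasLaw Z ((expMeasure (c p)).prod ((expMeasure (c q)).prod (expMeasure 1))) P :=
    (measurePreserving_burkeMap (hc p) (hc q) hab).hasLaw.comp hZ0
  have := isProbabilityMeasure_expMeasure (hc p)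
  have := isProbabilityMeasure_expMeasure (hc q)
  have := isProbabilityMeasure_expMeasure one_pos
  -- The index r receives the dual weight, so the new family keeps the index set and the laws of the
  -- old one.
  let Y : ι → Ω → ℝ := fun i => if i = p then fun ω => (Z ω).1 else
    if i = q then fun ω => (Z ω).2.1 else if i = r then fun ω => (Z ω).2.2 else X i
  have hYp : Y p = fun ω => (Z ω).1 := by simp [Y]
  have hYq : Y q = fun ω => (Z ω).2.1 := by simp [Y, hpq.symm]
  have hYr : Y r = fun ω => (Z ω).2.2 := by simp [Y, hpr.symm, hqr.symm]
  have hYi : ∀ i, i ≠ p → i ≠ q → i ≠ r → Y i = X i := by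
    intro i h1 h2 h3
    simp [Y, h1, h2, h3]
  have hYlaw : ∀ i, HasLaw (Y i) (expMeasure (c i)) P := by
    intro i
    by_cases h1 : i = p
    · subst h1
      rw [hYp]
      exact HasLaw.fun_comp (Y := Prod.fst) measurePreserving_fst.hasLaw hZ
    by_cases h2 : i = q
    · subst h2
      rw [hYq]
      exact HasLaw.fun_comp (Y := fun z => z.2.1)
        (measurePreserving_fst.hasLaw.comp measurePreserving_snd.hasLaw) hZ
    by_cases h3 : i = r
    · subst h3
      rw [hYr, hr]
      exact HasLaw.fun_comp (Y := fun z => z.2.2)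
        (measurePreserving_snd.hasLaw.comp measurePreserving_snd.hasLaw) hZ
    rw [hYi i h1 h2 h3]
    exact hlaw i
  refine ⟨Y, ?_, hYlaw, by rw [hYp]; rfl, by rw [hYq]; rfl, hYi⟩
  rw [iIndepFun_iff_measure_inter_preimage_eq_mul]
  intro S sets hsets
  -- Padding with `Set.univ` allows S to be enlarged by the three updated indices.
  let B : ι → Set ℝ := fun i => if i ∈ S then sets i else Set.univ
  have hB : ∀ i, MeasurableSet (B i) := by
    intro i
    by_cases h : i ∈ S
    · simp only [B, h, if_true]; exact hsets i h
    · simp only [B, h, if_false]; exact MeasurableSet.univ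
  let T : Finset ι := {p, q, r}
  have hT : ∀ i, i ∉ T ↔ i ≠ p ∧ i ≠ q ∧ i ≠ r := by intro i; simp [T]
  have hset : ⋂ i ∈ S, Y i ⁻¹' sets i =
      (⋂ i ∈ S \ T, X i ⁻¹' B i) ∩ Z ⁻¹' (B p ×ˢ B q ×ˢ B r) := by
    ext ω
    simp only [Set.mem_iInter, Set.mem_preimage, Set.mem_inter_iff, Set.mem_prod,
      Finset.mem_sdiff]
    constructor
    · intro h
      refine ⟨fun i hi => ?_, ?_, ?_, ?_⟩
      · obtain ⟨h1, h2, h3⟩ := (hT i).1 hi.2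
        have := h i hi.1
        rw [hYi i h1 h2 h3] at this
        simpa [B, hi.1] using this
      · by_cases hi : p ∈ S
        · have := h p hi
          rw [hYp] at this
          simpa [B, hi] using this
        · simp [B, hi]
      · by_cases hi : q ∈ S
        · have := h q hi
          rw [hYq] at this
          simpa [B, hi] using this
        · simp [B, hi]
      · by_cases hi : r ∈ S
        · have := h r hi
          rw [hYr] at this
          simpa [B, hi] using this
        · simp [B, hi]
    · rintro ⟨h, h1, h2, h3⟩ i hi
      by_cases e1 : i = p
      · subst e1; rw [hYp]; simpa [B, hi] using h1
      by_cases e2 : i = q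
      · subst e2; rw [hYq]; simpa [B, hi] using h2
      by_cases e3 : i = r
      · subst e3; rw [hYr]; simpa [B, hi] using h3
      rw [hYi i e1 e2 e3]
      simpa [B, hi] using h i ⟨hi, (hT i).2 ⟨e1, e2, e3⟩⟩
  have hindep : IndepFun (fun ω (i : (S \ T : Finset ι)) => X i ω) Z P := by
    have h := hX.indepFun_finset₀ (S \ T) T Finset.sdiff_disjoint hm
    have hg : Measurable fun x : T → ℝ => burkeMap (x ⟨p, by simp [T]⟩, x ⟨q, by simp [T]⟩,
        x ⟨r, by simp [T]⟩) := measurable_burkeMap.comp (by fun_prop)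
    exact h.comp measurable_id hg
  have hpre : ⋂ i ∈ S \ T, X i ⁻¹' B i =
      (fun ω (i : (S \ T : Finset ι)) => X i ω) ⁻¹' (Set.univ.pi fun i => B i) := by
    ext ω
    simp
  have hprod : ∏ i ∈ S, P (Y i ⁻¹' sets i) =
      (∏ i ∈ S \ T, P (X i ⁻¹' B i)) * ∏ i ∈ T, P (Y i ⁻¹' B i) := by
    have h1 : ∏ i ∈ S \ T, P (X i ⁻¹' B i) = ∏ i ∈ S \ T, P (Y i ⁻¹' B i) := by
      refine Finset.prod_congr rfl fun i hi => ?_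
      obtain ⟨h1, h2, h3⟩ := (hT i).1 (Finset.mem_sdiff.1 hi).2
      rw [hYi i h1 h2 h3]
    rw [h1, ← Finset.prod_union Finset.sdiff_disjoint, Finset.sdiff_union_self_eq_union]
    rw [← Finset.prod_subset (Finset.subset_union_left (s₁ := S) (s₂ := T))]
    · refine Finset.prod_congr rfl fun i hi => ?_
      simp [B, hi]
    · intro i _ hi
      simp [B, hi]
  have hTprod : ∏ i ∈ T, P (Y i ⁻¹' B i) = expMeasure (c p) (B p) *
      (expMeasure (c q) (B q) * expMeasure 1 (B r)) := by
    have hl : ∀ i, P (Y i ⁻¹' B i) = expMeasure (c i) (B i) := by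
      intro i
      rw [← (hYlaw i).map_eq, Measure.map_apply_of_aemeasurable (hYlaw i).aemeasurable (hB i)]
    simp_rw [hl]
    rw [Finset.prod_insert (by simp [hpq, hpr]), Finset.prod_insert (by simp [hqr]),
      Finset.prod_singleton, hr]
  have hZm : P (Z ⁻¹' (B p ×ˢ B q ×ˢ B r)) = expMeasure (c p) (B p) *
      (expMeasure (c q) (B q) * expMeasure 1 (B r)) := by
    rw [← Measure.map_apply_of_aemeasurable hZ.aemeasurable
      ((hB p).prod ((hB q).prod (hB r))), hZ.map_eq, Measure.prod_prod, Measure.prod_prod]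
  rw [hprod, hTprod, ← hZm, hset, hpre, hindep.measure_inter_preimage_eq_mul _ _
    (MeasurableSet.univ_pi fun i => hB i) ((hB p).prod ((hB q).prod (hB r))), ← hpre,
    hX.measure_inter_preimage_eq_mul (S \ T) fun i _ => hB i]

end

/-! ### Stationary last-passage times. -/

section

/-- The environment `w` seen from `u`, restricted to the quadrant. -/
def shiftEnv (w : ℤ × ℤ → ℝ) (u : ℤ × ℤ) (i j : ℕ) : ℝ := w (u + ((i : ℤ), (j : ℤ)))

/-- The stationary environment on the quadrant: zero weight at the corner, weights of rates `a`
and `b` on the axes, and the environment `w` seen from `u` in the bulk. The weights on the axes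
are obtained from the row and the column of `w` next to the quadrant. -/
noncomputable def statEnv (w : ℤ × ℤ → ℝ) (u : ℤ × ℤ) (a b : ℝ) : ℕ → ℕ → ℝ
  | 0, 0 => 0
  | i + 1, 0 => w (u + ((i : ℤ), -1)) / a
  | 0, j + 1 => w (u + (-1, (j : ℤ))) / b
  | i + 1, j + 1 => w (u + ((i : ℤ), (j : ℤ)))

theorem statEnv_nonneg {w : ℤ × ℤ → ℝ} (hw : ∀ z, 0 ≤ w z) (u : ℤ × ℤ) {a b : ℝ} (ha : 0 < a)
    (hb : 0 < b) (i j : ℕ) : 0 ≤ statEnv w u a b i j := by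
  cases i <;> cases j <;> simp only [statEnv] <;> first | exact le_rfl | exact hw _ |
    exact div_nonneg (hw _) (by positivity)

/-- The rates of the weights of the stationary environment. -/
noncomputable def statRate (a b : ℝ) : ℕ × ℕ → ℝ
  | (0, 0) => 1
  | (_ + 1, 0) => a
  | (0, _ + 1) => b
  | (_ + 1, _ + 1) => 1

theorem statRate_pos {a b : ℝ} (ha : 0 < a) (hb : 0 < b) (z : ℕ × ℕ) : 0 < statRate a b z := by
  obtain ⟨i, j⟩ := z
  cases i <;> cases j <;> simp [statRate, ha, hb]

variable {Ω : Type*} [MeasurableSpace Ω] {P : Measure Ω} [IsProbabilityMeasure P]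

/-- The increments of the stationary last-passage process along a row are independent. -/
theorem exists_row_increments {η : ℕ × ℕ → Ω → ℝ} {a b : ℝ} (ha : 0 < a) (hb : 0 < b)
    (hab : a + b = 1) (hη : iIndepFun η P)
    (hlaw : ∀ z, HasLaw (η z) (expMeasure (statRate a b z)) P)
    {H : Ω → ℕ → ℕ → ℝ} (hH : ∀ ω i j, (i, j) ≠ (0, 0) → H ω i j = η (i, j) ω) (m n : ℕ) :
    ∃ X : ℕ × ℕ → Ω → ℝ, iIndepFun X P ∧
      (∀ z, HasLaw (X z) (expMeasure (statRate a b z)) P) ∧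
      (∀ k < m, X (k + 1, 0) = fun ω => lpp (H ω) (k + 1) n - lpp (H ω) k n) ∧
      ∀ l > n, ∀ k, X (k, l) = η (k, l) := by
  induction n with
  | zero =>
    refine ⟨η, hη, hlaw, fun k _ => ?_, fun _ _ _ => rfl⟩
    funext ω
    rw [lpp, hH ω (k + 1) 0 (by simp)]
    ring
  | succ n ih =>
    -- The family follows a down-right path: row n + 1 up to column i, one vertical edge down, then
    -- row n. Index (0, n + 1) stores the vertical increment at column i, and (k + 1, n + 1) with k
    -- ≥ i the bulk weights not yet used. Each corner flip is one Burke update.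
    have key : ∀ i ≤ m, ∃ X : ℕ × ℕ → Ω → ℝ, iIndepFun X P ∧
        (∀ z, HasLaw (X z) (expMeasure (statRate a b z)) P) ∧
        (∀ k < i, X (k + 1, 0) = fun ω => lpp (H ω) (k + 1) (n + 1) - lpp (H ω) k (n + 1)) ∧
        (∀ k < m, i ≤ k → X (k + 1, 0) = fun ω => lpp (H ω) (k + 1) n - lpp (H ω) k n) ∧
        (X (0, n + 1) = fun ω => lpp (H ω) i (n + 1) - lpp (H ω) i n) ∧
        (∀ k ≥ i, X (k + 1, n + 1) = η (k + 1, n + 1)) ∧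
        ∀ l > n + 1, ∀ k, X (k, l) = η (k, l) := by
      intro i
      induction i with
      | zero =>
        intro _
        obtain ⟨X, h1, h2, h3, h4⟩ := ih
        refine ⟨X, h1, h2, fun k hk => absurd hk (by omega), fun k hk _ => h3 k hk, ?_,
          fun k _ => h4 _ (by omega) _, fun l hl k => h4 l (by omega) k⟩
        rw [h4 _ (by omega)]
        funext ω
        rw [lpp, hH ω 0 (n + 1) (by simp)]
        ring
      | succ i ihi =>
        intro hi
        obtain ⟨X, h1, h2, h3, h4, h5, h6, h7⟩ := ihi (by omega)
        obtain ⟨Y, y1, y2, y3, y4, y5⟩ := exists_burke_update h1 (statRate_pos ha hb) h2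
          (p := (i + 1, 0)) (q := (0, n + 1)) (r := (i + 1, n + 1)) (by simp) (by simp) (by simp)
          rfl hab
        refine ⟨Y, y1, y2, fun k hk => ?_, fun k hk hik => ?_, ?_, fun k hk => ?_,
          fun l hl k => ?_⟩
        -- For the new edge: max(A, B) + η - A = η + max(B - A, 0), and B - A is the old horizontal
        -- increment minus the vertical one.
        · rcases Nat.lt_succ_iff_lt_or_eq.1 hk with hk | rfl
          · rw [y5 _ (by simp; omega) (by simp) (by simp), h3 k hk]
          · rw [y3, h4 k (by omega) le_rfl, h5, h6 k le_rfl]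
            funext ω
            rw [← hH ω (k + 1) (n + 1) (by simp), lpp.eq_4]
            rcases le_total (lpp (H ω) k (n + 1)) (lpp (H ω) (k + 1) n) with h | h
            · rw [max_eq_left (by linarith), max_eq_right h]; ring
            · rw [max_eq_right (by linarith), max_eq_left h]; ring
        · rw [y5 _ (by simp; omega) (by simp) (by simp), h4 k hk (by omega)]
        · rw [y4, h4 i (by omega) le_rfl, h5, h6 i le_rfl]
          funext ω
          rw [← hH ω (i + 1) (n + 1) (by simp), lpp.eq_4]
          rcases le_total (lpp (H ω) i (n + 1)) (lpp (H ω) (i + 1) n) with h | h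
          · rw [max_eq_right (by linarith), max_eq_right h]; ring
          · rw [max_eq_left (by linarith), max_eq_left h]; ring
        · rw [y5 _ (by simp) (by simp) (by simp; omega), h6 k (by omega)]
        · rw [y5 _ (by simp; omega) (by simp; omega) (by simp; omega), h7 l hl k]
    obtain ⟨X, h1, h2, h3, -, -, -, h7⟩ := key m le_rfl
    exact ⟨X, h1, h2, h3, h7⟩

/-- The stationary last-passage time is the sum of the weights on the vertical axis and of an
independent family of exponential variables. -/
theorem exists_lpp_eq_sum {η : ℕ × ℕ → Ω → ℝ} {a b : ℝ} (ha : 0 < a) (hb : 0 < b)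
    (hab : a + b = 1) (hη : iIndepFun η P)
    (hlaw : ∀ z, HasLaw (η z) (expMeasure (statRate a b z)) P)
    {H : Ω → ℕ → ℕ → ℝ} (h0 : ∀ ω, H ω 0 0 = 0)
    (hH : ∀ ω i j, (i, j) ≠ (0, 0) → H ω i j = η (i, j) ω) (m n : ℕ) :
    ∃ X : ℕ → Ω → ℝ, iIndepFun X P ∧ (∀ k, HasLaw (X k) (expMeasure a) P) ∧
      ∀ ω, lpp (H ω) m n = ∑ l ∈ Finset.range n, H ω 0 (l + 1) + ∑ k ∈ Finset.range m, X k ω := by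
  obtain ⟨X, h1, h2, h3, -⟩ := exists_row_increments ha hb hab hη hlaw hH m n
  refine ⟨fun k => X (k + 1, 0), h1.precomp (g := fun k : ℕ => (k + 1, 0)) ?_,
    fun k => h2 (k + 1, 0), fun ω => ?_⟩
  · intro k l h
    simpa using h
  · have hcol : ∀ n, lpp (H ω) 0 n = ∑ l ∈ Finset.range n, H ω 0 (l + 1) := by
      intro n
      induction n with
      | zero => simp [lpp, h0]
      | succ n ih => rw [lpp, ih, Finset.sum_range_succ]
    have : ∑ k ∈ Finset.range m, X (k + 1, 0) ω =
        ∑ k ∈ Finset.range m, (lpp (H ω) (k + 1) n - lpp (H ω) k n) := by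
      refine Finset.sum_congr rfl fun k hk => ?_
      rw [h3 k (Finset.mem_range.1 hk)]
    rw [this, Finset.sum_range_sub (fun k => lpp (H ω) k n), hcol]
    ring

section Tails

/-- Multiplication by a reduces to rate 1. The lower bound α on the rate makes the exponent
independent of a. -/
theorem sum_upper_tail_rate {X : ℕ → Ω → ℝ} (hind : iIndepFun X P) {a α : ℝ} (hα : 0 < α)
    (ha : α ≤ a) (hlaw : ∀ i, HasLaw (X i) (expMeasure a) P) {n N : ℕ} (hn : n ≤ N) {ε : ℝ}
    (h0 : 0 ≤ ε) (h1 : ε * α ≤ 1) :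
    P.real {ω | n / a + ε * N ≤ ∑ i ∈ Finset.range n, X i ω} ≤
      Real.exp (-((ε * α) ^ 2 / 4 * N)) := by
  have ha0 : 0 < a := hα.trans_le ha
  have hi : iIndepFun (fun i ω => a * X i ω) P :=
    hind.comp (fun _ x => a * x) fun _ => by fun_prop
  have hl : ∀ i, HasLaw (fun ω => a * X i ω) (expMeasure 1) P := fun i => by
    have := hasLaw_const_mul_exp ha0 ha0 (hlaw i)
    rwa [div_self ha0.ne'] at this
  refine le_trans (measureReal_mono fun ω hω => ?_)
    (sum_upper_tail hi hl (Finset.range n) (N := N) (by simpa) (by positivity) h1)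
  simp only [Set.mem_ofPred_eq, Finset.card_range] at hω ⊢
  rw [← Finset.mul_sum]
  have h2 := mul_le_mul_of_nonneg_left hω ha0.le
  have h3 : a * (n / a + ε * N) = n + ε * a * N := by field_simp
  have h4 : ε * α * N ≤ ε * a * N := by gcongr
  linarith

theorem sum_lower_tail_rate {X : ℕ → Ω → ℝ} (hind : iIndepFun X P) {a α : ℝ} (hα : 0 < α)
    (ha : α ≤ a) (hlaw : ∀ i, HasLaw (X i) (expMeasure a) P) {n N : ℕ} (hn : n ≤ N) {ε : ℝ}
    (h0 : 0 ≤ ε) (h1 : ε * α ≤ 1) :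
    P.real {ω | ∑ i ∈ Finset.range n, X i ω ≤ n / a - ε * N} ≤
      Real.exp (-((ε * α) ^ 2 / 4 * N)) := by
  have ha0 : 0 < a := hα.trans_le ha
  have hi : iIndepFun (fun i ω => a * X i ω) P :=
    hind.comp (fun _ x => a * x) fun _ => by fun_prop
  have hl : ∀ i, HasLaw (fun ω => a * X i ω) (expMeasure 1) P := fun i => by
    have := hasLaw_const_mul_exp ha0 ha0 (hlaw i)
    rwa [div_self ha0.ne'] at this
  refine le_trans (measureReal_mono fun ω hω => ?_)
    (sum_lower_tail hi hl (Finset.range n) (N := N) (by simpa) (by positivity) h1)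
  simp only [Set.mem_ofPred_eq, Finset.card_range] at hω ⊢
  rw [← Finset.mul_sum]
  have h2 := mul_le_mul_of_nonneg_left hω ha0.le
  have h3 : a * (n / a - ε * N) = n - ε * a * N := by field_simp
  have h4 : ε * α * N ≤ ε * a * N := by gcongr
  linarith

end Tails

end

/-! ### Concentration of stationary times and the choice of the rate. -/

section

theorem hasLaw_div {Ω : Type*} [MeasurableSpace Ω] {P : Measure Ω} {X : Ω → ℝ}
    (hX : HasLaw X (expMeasure 1) P) {a : ℝ} (ha : 0 < a) :
    HasLaw (fun ω => X ω / a) (expMeasure a) P := by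
  have := hasLaw_const_mul_exp one_pos (inv_pos.2 ha) hX
  simpa [div_eq_inv_mul] using this

section Stationary

variable {Ω : Type*} [MeasurableSpace Ω] {P : Measure Ω} [IsProbabilityMeasure P]
  {w : ℤ × ℤ → Ω → ℝ}

theorem statEnv_row_upper (hind : iIndepFun w P) (hlaw : ∀ z, HasLaw (w z) (expMeasure 1) P)
    (u : ℤ × ℤ) {a b α : ℝ} (hα : 0 < α) (ha : α ≤ a) {n N : ℕ} (hn : n ≤ N) {ε : ℝ}
    (h0 : 0 ≤ ε) (h1 : ε * α ≤ 1) :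
    P.real {ω | n / a + ε * N ≤
      ∑ t ∈ Finset.range n, statEnv (fun z => w z ω) u a b (t + 1) 0} ≤
      Real.exp (-((ε * α) ^ 2 / 4 * N)) := by
  have hi : iIndepFun (fun (t : ℕ) ω => w (u + ((t : ℤ), -1)) ω / a) P :=
    (hind.precomp (g := fun t : ℕ => u + ((t : ℤ), -1)) (fun s t h => by simpa using h)).comp
      (fun _ x => x / a) fun _ => by fun_prop
  exact sum_upper_tail_rate hi hα ha (fun i => hasLaw_div (hlaw _) (hα.trans_le ha)) hn h0 h1

theorem statEnv_col_upper (hind : iIndepFun w P) (hlaw : ∀ z, HasLaw (w z) (expMeasure 1) P)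
    (u : ℤ × ℤ) {a b α : ℝ} (hα : 0 < α) (hb : α ≤ b) {n N : ℕ} (hn : n ≤ N) {ε : ℝ}
    (h0 : 0 ≤ ε) (h1 : ε * α ≤ 1) :
    P.real {ω | n / b + ε * N ≤
      ∑ t ∈ Finset.range n, statEnv (fun z => w z ω) u a b 0 (t + 1)} ≤
      Real.exp (-((ε * α) ^ 2 / 4 * N)) := by
  have hi : iIndepFun (fun (t : ℕ) ω => w (u + (-1, (t : ℤ))) ω / b) P :=
    (hind.precomp (g := fun t : ℕ => u + (-1, (t : ℤ))) (fun s t h => by simpa using h)).comp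
      (fun _ x => x / b) fun _ => by fun_prop
  exact sum_upper_tail_rate hi hα hb (fun i => hasLaw_div (hlaw _) (hα.trans_le hb)) hn h0 h1

theorem statEnv_col_lower (hind : iIndepFun w P) (hlaw : ∀ z, HasLaw (w z) (expMeasure 1) P)
    (u : ℤ × ℤ) {a b α : ℝ} (hα : 0 < α) (hb : α ≤ b) {n N : ℕ} (hn : n ≤ N) {ε : ℝ}
    (h0 : 0 ≤ ε) (h1 : ε * α ≤ 1) :
    P.real {ω | ∑ t ∈ Finset.range n, statEnv (fun z => w z ω) u a b 0 (t + 1) ≤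
      n / b - ε * N} ≤
      Real.exp (-((ε * α) ^ 2 / 4 * N)) := by
  have hi : iIndepFun (fun (t : ℕ) ω => w (u + (-1, (t : ℤ))) ω / b) P :=
    (hind.precomp (g := fun t : ℕ => u + (-1, (t : ℤ))) (fun s t h => by simpa using h)).comp
      (fun _ x => x / b) fun _ => by fun_prop
  exact sum_lower_tail_rate hi hα hb (fun i => hasLaw_div (hlaw _) (hα.trans_le hb)) hn h0 h1

theorem shiftEnv_row_lower (hind : iIndepFun w P) (hlaw : ∀ z, HasLaw (w z) (expMeasure 1) P)
    (u : ℤ × ℤ) {n N : ℕ} (hn : n ≤ N) {ε : ℝ} (h0 : 0 ≤ ε) (h1 : ε ≤ 1) :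
    P.real {ω | ∑ t ∈ Finset.range n, shiftEnv (fun z => w z ω) u t 0 ≤ n - ε * N} ≤
      Real.exp (-(ε ^ 2 / 4 * N)) := by
  have hi : iIndepFun (fun t : ℕ => w (u + ((t : ℤ), ((0 : ℕ) : ℤ)))) P :=
    hind.precomp (g := fun t : ℕ => u + ((t : ℤ), ((0 : ℕ) : ℤ))) fun s t h => by simpa using h
  simpa [shiftEnv] using sum_lower_tail hi (fun _ => hlaw _) (Finset.range n) (N := N) (by simpa) h0 h1

theorem shiftEnv_col_lower (hind : iIndepFun w P) (hlaw : ∀ z, HasLaw (w z) (expMeasure 1) P)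
    (u : ℤ × ℤ) {n N : ℕ} (hn : n ≤ N) {ε : ℝ} (h0 : 0 ≤ ε) (h1 : ε ≤ 1) :
    P.real {ω | ∑ t ∈ Finset.range n, shiftEnv (fun z => w z ω) u 0 t ≤ n - ε * N} ≤
      Real.exp (-(ε ^ 2 / 4 * N)) := by
  have hi : iIndepFun (fun t : ℕ => w (u + (((0 : ℕ) : ℤ), (t : ℤ)))) P :=
    hind.precomp (g := fun t : ℕ => u + (((0 : ℕ) : ℤ), (t : ℤ))) fun s t h => by simpa using h
  simpa [shiftEnv] using sum_lower_tail hi (fun _ => hlaw _) (Finset.range n) (N := N) (by simpa) h0 h1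

theorem exists_lpp_statEnv_eq (hind : iIndepFun w P)
    (hlaw : ∀ z, HasLaw (w z) (expMeasure 1) P) (u : ℤ × ℤ) {a b : ℝ} (ha : 0 < a) (hb : 0 < b)
    (hab : a + b = 1) (m n : ℕ) :
    ∃ X : ℕ → Ω → ℝ, iIndepFun X P ∧ (∀ k, HasLaw (X k) (expMeasure a) P) ∧
      ∀ ω, lpp (statEnv (fun z => w z ω) u a b) m n =
        ∑ l ∈ Finset.range n, statEnv (fun z => w z ω) u a b 0 (l + 1) +
          ∑ k ∈ Finset.range m, X k ω := by
  -- The shift by (-1, -1) puts the axes just outside the quadrant at u. The variable at index (0,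
  -- 0) is a dummy: the stationary environment has weight 0 there.
  let pos : ℕ × ℕ → ℤ × ℤ := fun z => u + ((z.1 : ℤ) - 1, (z.2 : ℤ) - 1)
  have hpos : pos.Injective := by
    rintro ⟨i, j⟩ ⟨k, l⟩ h
    simpa [pos] using h
  have hi : iIndepFun (fun z ω => w (pos z) ω / statRate a b z) P :=
    (hind.precomp hpos).comp (fun z x => x / statRate a b z) fun _ => by fun_prop
  refine exists_lpp_eq_sum ha hb hab hi
    (fun z => hasLaw_div (hlaw _) (statRate_pos ha hb z)) (fun ω => rfl) ?_ m n
  intro ω i j hij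
  cases i <;> cases j
  · exact absurd rfl hij
  · simp [statEnv, statRate, pos]
  · simp [statEnv, statRate, pos]
  · simp [statEnv, statRate, pos]

/-- Going up the vertical axis and then along row n gives two sums of independent variables. A union
bound needs no independence between the two. -/
theorem lpp_statEnv_upper (hind : iIndepFun w P)
    (hlaw : ∀ z, HasLaw (w z) (expMeasure 1) P) (u : ℤ × ℤ) {a b α : ℝ} (hα : 0 < α)
    (ha : α ≤ a) (hb : α ≤ b) (hab : a + b = 1) {m n N : ℕ} (hm : m ≤ N) (hn : n ≤ N) {ε : ℝ}
    (h0 : 0 ≤ ε) (h1 : ε * α ≤ 1) :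
    P.real {ω | m / a + n / b + 2 * ε * N ≤ lpp (statEnv (fun z => w z ω) u a b) m n} ≤
      2 * Real.exp (-((ε * α) ^ 2 / 4 * N)) := by
  obtain ⟨X, hX, hl, he⟩ := exists_lpp_statEnv_eq hind hlaw u (hα.trans_le ha) (hα.trans_le hb)
    hab m n
  have h2 := statEnv_col_upper hind hlaw u (a := a) hα hb hn h0 h1
  have h3 := sum_upper_tail_rate hX hα ha hl hm h0 h1
  rw [two_mul (Real.exp _)]
  refine le_trans ?_ (add_le_add h2 h3)
  refine le_trans (measureReal_mono fun ω hω => ?_) (measureReal_union_le _ _)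
  simp only [Set.mem_ofPred_eq, Set.mem_union, he] at hω ⊢
  by_contra! h
  linarith

theorem lpp_statEnv_lower (hind : iIndepFun w P)
    (hlaw : ∀ z, HasLaw (w z) (expMeasure 1) P) (u : ℤ × ℤ) {a b α : ℝ} (hα : 0 < α)
    (ha : α ≤ a) (hb : α ≤ b) (hab : a + b = 1) {m n N : ℕ} (hm : m ≤ N) (hn : n ≤ N) {ε : ℝ}
    (h0 : 0 ≤ ε) (h1 : ε * α ≤ 1) :
    P.real {ω | lpp (statEnv (fun z => w z ω) u a b) m n ≤ m / a + n / b - 2 * ε * N} ≤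
      2 * Real.exp (-((ε * α) ^ 2 / 4 * N)) := by
  obtain ⟨X, hX, hl, he⟩ := exists_lpp_statEnv_eq hind hlaw u (hα.trans_le ha) (hα.trans_le hb)
    hab m n
  have h2 := statEnv_col_lower hind hlaw u (a := a) hα hb hn h0 h1
  have h3 := sum_lower_tail_rate hX hα ha hl hm h0 h1
  rw [two_mul (Real.exp _)]
  refine le_trans ?_ (add_le_add h2 h3)
  refine le_trans (measureReal_mono fun ω hω => ?_) (measureReal_union_le _ _)
  simp only [Set.mem_ofPred_eq, Set.mem_union, he] at hω ⊢
  by_contra! h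
  linarith

end Stationary

section Rate

/-- The rate on the horizontal axis that is nearly optimal for the direction `(s ^ 2, t ^ 2)`,
kept away from `0` and `1` by the parameter `d`. -/
noncomputable def optRate (s t d : ℝ) : ℝ := (s + d) / (s + t + 2 * d)

theorem optRate_add_swap {s t d : ℝ} (hs : 0 ≤ s) (ht : 0 ≤ t) (hd : 0 < d) :
    optRate s t d + optRate t s d = 1 := by
  have : 0 < s + t + 2 * d := by linarith
  unfold optRate
  rw [add_comm t s]
  field_simp
  ring

theorem le_optRate {s t δ R : ℝ} (hs : 0 ≤ s) (ht : 0 ≤ t) (hδ : 0 < δ) (hδ1 : δ ≤ 1) (hR : 0 < R)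
    (htR : t ≤ R) : δ / 4 ≤ optRate s t (δ * R) := by
  have : 0 < s + t + 2 * (δ * R) := by positivity
  unfold optRate
  rw [le_div_iff₀ this]
  have : δ * R ≤ R := mul_le_of_le_one_left hR.le hδ1
  nlinarith

/-- Added to its mirror image, this shows that the regularization d costs at most 2d(s + t) over the
optimal value (s + t)². -/
theorem sq_div_optRate_le {s t d : ℝ} (hs : 0 ≤ s) (ht : 0 ≤ t) (hd : 0 < d) :
    s ^ 2 / optRate s t d ≤ s * (s + t + 2 * d) := by
  have h1 : 0 < s + t + 2 * d := by linarith
  have h2 : 0 < s + d := by linarith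
  unfold optRate
  rw [div_div_eq_mul_div, div_le_iff₀ h2]
  nlinarith [mul_nonneg (mul_nonneg hs h1.le) hd.le]

/-- Cauchy–Schwarz: with s² = i and t² = j, no stationary mean is below the shape. -/
theorem add_sq_le_div_add_div {a b : ℝ} (ha : 0 < a) (hb : 0 < b) (hab : a + b = 1) (s t : ℝ) :
    (s + t) ^ 2 ≤ s ^ 2 / a + t ^ 2 / b := by
  obtain rfl : b = 1 - a := by linarith
  rw [div_add_div _ _ ha.ne' hb.ne', le_div_iff₀ (mul_pos ha hb)]
  nlinarith [sq_nonneg (s * (1 - a) - t * a)]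

/-- The loss of a path that leaves the axis at distance `s ^ 2 - q ^ 2` from the corner. -/
theorem exit_loss {s t q d r E : ℝ} (hq : 0 ≤ q) (hqs : q ≤ s) (hd : 0 ≤ d)
    (hr : 0 ≤ r) (hrs : r * (s + d) = t + d)
    (h : (s + t) ^ 2 ≤ (s ^ 2 - q ^ 2) * (1 + r) + (q + t) ^ 2 + E) (hE : 0 ≤ E) :
    ((s ^ 2 - q ^ 2) * r) ^ 2 ≤ 4 * (E + 2 * d * s) * (s * (t + d)) := by
  have hs : 0 ≤ s := hq.trans hqs
  have h1 : (s - q) * (2 * t - (s + q) * r) ≤ E := by nlinarith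
  -- By `hrs`, 2t = 2rs + 2d(r - 1), so the right side equals (s - q)r + 2d(r - 1).
  have h2 : (s - q) * r - 2 * d ≤ 2 * t - (s + q) * r := by nlinarith [mul_nonneg hr hd]
  have h3 : (s - q) ^ 2 * r ≤ E + 2 * d * s := by
    have := mul_le_mul_of_nonneg_left h2 (sub_nonneg.2 hqs)
    nlinarith [mul_nonneg hd hq]
  have h4 : (s + q) ^ 2 * r ≤ 4 * (s * (t + d)) := by
    have h5 : (s + q) ^ 2 ≤ 4 * s ^ 2 := by nlinarith
    have h6 := mul_le_mul_of_nonneg_right h5 hr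
    have h7 : s * (t + d) = s ^ 2 * r + s * d * r := by rw [← hrs]; ring
    have : 0 ≤ s * d * r := by positivity
    linarith
  calc ((s ^ 2 - q ^ 2) * r) ^ 2 = ((s - q) ^ 2 * r) * ((s + q) ^ 2 * r) := by ring
    _ ≤ (E + 2 * d * s) * (4 * (s * (t + d))) := by
      apply mul_le_mul h3 h4 (by positivity) (by positivity)
    _ = _ := by ring

end Rate

end

/-! ### Tail bounds around the limit shape. -/

section

/-- The limit shape of the corner growth model with exponential weights. -/
noncomputable def shape (i j : ℕ) : ℝ := (√(i : ℝ) + √(j : ℝ)) ^ 2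

theorem ae_forall_nonneg {Ω : Type*} [MeasurableSpace Ω] {P : Measure Ω} {w : ℤ × ℤ → Ω → ℝ}
    (hlaw : ∀ z, HasLaw (w z) (expMeasure 1) P) :
    ∀ᵐ ω ∂P, ∀ z, 0 ≤ w z ω :=
  ae_all_iff.2 fun z => ae_nonneg_of_hasLaw_exp (hlaw z)

theorem exists_rates {ε : ℝ} (h0 : 0 < ε) (h1 : ε ≤ 1) {i j N : ℕ} (hN : 0 < N) (hi : i ≤ N)
    (hj : j ≤ N) :
    ∃ a b : ℝ, ε / 4 ≤ a ∧ ε / 4 ≤ b ∧ a + b = 1 ∧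
      (i : ℝ) / a + j / b ≤ shape i j + 4 * ε * N ∧
      a * (√(j : ℝ) + ε * √(N : ℝ)) = b * (√(i : ℝ) + ε * √(N : ℝ)) := by
  have hR : 0 < √(N : ℝ) := Real.sqrt_pos.2 (by exact_mod_cast hN)
  have hs : √(i : ℝ) ≤ √(N : ℝ) := Real.sqrt_le_sqrt (by exact_mod_cast hi)
  have ht : √(j : ℝ) ≤ √(N : ℝ) := Real.sqrt_le_sqrt (by exact_mod_cast hj)
  have hs0 := Real.sqrt_nonneg (i : ℝ)
  have ht0 := Real.sqrt_nonneg (j : ℝ)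
  have hd : 0 < ε * √(N : ℝ) := mul_pos h0 hR
  have es : √(i : ℝ) ^ 2 = i := Real.sq_sqrt (by positivity)
  have et : √(j : ℝ) ^ 2 = j := Real.sq_sqrt (by positivity)
  have eN : √(N : ℝ) ^ 2 = N := Real.sq_sqrt (by positivity)
  refine ⟨optRate √(i : ℝ) √(j : ℝ) (ε * √(N : ℝ)), optRate √(j : ℝ) √(i : ℝ) (ε * √(N : ℝ)),
    le_optRate hs0 ht0 h0 h1 hR ht, le_optRate ht0 hs0 h0 h1 hR hs,
    optRate_add_swap hs0 ht0 hd, ?_, ?_⟩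
  · have e1 := sq_div_optRate_le hs0 ht0 hd
    have e2 := sq_div_optRate_le ht0 hs0 hd
    rw [es] at e1
    rw [et] at e2
    have e3 : (√(i : ℝ) + √(j : ℝ)) * (2 * (ε * √(N : ℝ))) ≤ 4 * ε * N := by
      calc _ ≤ (√(N : ℝ) + √(N : ℝ)) * (2 * (ε * √(N : ℝ))) := by gcongr
        _ = 4 * ε * √(N : ℝ) ^ 2 := by ring
        _ = _ := by rw [eN]
    unfold shape
    nlinarith
  · unfold optRate
    rw [add_comm √(j : ℝ) √(i : ℝ)]
    ring

variable {Ω : Type*} [MeasurableSpace Ω] {P : Measure Ω} [IsProbabilityMeasure P]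
  {w : ℤ × ℤ → Ω → ℝ}

/-- The upper tail of last-passage times, uniformly in the endpoints. -/
theorem exists_lpp_upper_tail (hind : iIndepFun w P)
    (hlaw : ∀ z, HasLaw (w z) (expMeasure 1) P) {ε : ℝ} (h0 : 0 < ε) (h1 : ε ≤ 1) :
    ∃ κ > 0, ∃ N₀ : ℕ, ∀ N ≥ N₀, ∀ u : ℤ × ℤ, ∀ i < N, ∀ j < N,
      P.real {ω | shape i j + ε * N ≤ lpp (shiftEnv (fun z => w z ω) u) i j} ≤
        2 * Real.exp (-(κ * N)) := by
  have hδ0 : 0 < ε / 16 := by positivity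
  have hα0 : 0 < ε / 16 / 4 := by positivity
  -- The error εN is spent as follows: εN/4 on the regularized rate, εN/2 on stationary
  -- fluctuations, and εN/4 on 1/a + 1/b ≤ 128/ε from the shift to (i + 1, j + 1).
  refine ⟨(ε / 4 * (ε / 16 / 4)) ^ 2 / 4, by positivity, ⌈512 / ε ^ 2⌉₊ + 1, ?_⟩
  intro N hN u i hi j hj
  have hN' : 512 / ε ^ 2 ≤ N := (Nat.le_ceil _).trans (by exact_mod_cast (by omega))
  rw [div_le_iff₀ (by positivity)] at hN'
  obtain ⟨a, b, ha, hb, hab, hab', -⟩ := exists_rates hδ0 (by linarith : ε / 16 ≤ 1)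
    (by omega) hi.le hj.le
  have ha0 := hα0.trans_le ha
  have hb0 := hα0.trans_le hb
  refine le_trans ?_ (lpp_statEnv_upper hind hlaw u hα0 ha hb hab
    (Nat.succ_le_of_lt hi) (Nat.succ_le_of_lt hj) (ε := ε / 4) (by positivity) (by nlinarith))
  refine ENNReal.toReal_mono (measure_ne_top _ _) (measure_mono_ae ?_)
  filter_upwards [ae_forall_nonneg hlaw] with ω hω h
  have h2 := lpp_shift_diag (statEnv_nonneg hω u ha0 hb0) i j
  have h3 : (fun a' b' => statEnv (fun z => w z ω) u a b (a' + 1) (b' + 1)) =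
      shiftEnv (fun z => w z ω) u := rfl
  rw [h3] at h2
  change shape i j + ε * N ≤ lpp (shiftEnv (fun z => w z ω) u) i j at h
  change ((i + 1 : ℕ) : ℝ) / a + ((j + 1 : ℕ) : ℝ) / b + 2 * (ε / 4) * N ≤ _
  have h4 : 1 / a ≤ 64 / ε := by
    rw [div_le_div_iff₀ ha0 h0]; linarith
  have h5 : 1 / b ≤ 64 / ε := by
    rw [div_le_div_iff₀ hb0 h0]; linarith
  have h6 : 128 / ε ≤ ε / 4 * N := by
    rw [div_le_iff₀ h0]; nlinarith
  push_cast
  rw [add_div, add_div]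
  have h7 : 64 / ε + 64 / ε = 128 / ε := by ring
  linarith

/-- The deterministic part of the lower bound: if the stationary last-passage time is large and
the axis and the last-passage times in the bulk are not too large, then the path cannot gain
much from leaving the corner along the axis. -/
theorem exit_lower_bound {ε : ℝ} (h0 : 0 < ε) (h1 : ε ≤ 1) {i j k N : ℕ} (hN : 0 < N)
    (hk : k ≤ i) (hi : i ≤ N) (hj : j ≤ N) {a b : ℝ} (ha : ε / 4 ≤ a) (hb : ε / 4 ≤ b)
    (hab : a + b = 1)
    (hr : a * (√(j : ℝ) + ε * √(N : ℝ)) = b * (√(i : ℝ) + ε * √(N : ℝ)))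
    (hN' : 4 / ε ≤ ε * N) {G S L B W : ℝ}
    (hG : (i + 1) / a + (j + 1) / b - 2 * ε * N ≤ G) (hexit : G ≤ S + L)
    (hS : S ≤ (k + 1) / a + ε * N) (hL : L ≤ shape (i - k) j + ε * N)
    (hW : k - ε * N ≤ W) (hB : W + L ≤ B) :
    shape i j - 13 * √ε * N ≤ B := by
  have hα : 0 < ε / 4 := by positivity
  have ha0 := hα.trans_le ha
  have hb0 := hα.trans_le hb
  have hNr : (0 : ℝ) < N := by exact_mod_cast hN
  have hs : √(i : ℝ) ≤ √(N : ℝ) := Real.sqrt_le_sqrt (by exact_mod_cast hi)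
  have ht : √(j : ℝ) ≤ √(N : ℝ) := Real.sqrt_le_sqrt (by exact_mod_cast hj)
  have hR := Real.sqrt_nonneg (N : ℝ)
  have hs0 := Real.sqrt_nonneg (i : ℝ)
  have ht0 := Real.sqrt_nonneg (j : ℝ)
  have hq0 := Real.sqrt_nonneg ((i - k : ℕ) : ℝ)
  have hqs : √((i - k : ℕ) : ℝ) ≤ √(i : ℝ) := Real.sqrt_le_sqrt (by exact_mod_cast Nat.sub_le _ _)
  have es : √(i : ℝ) ^ 2 = i := Real.sq_sqrt (by positivity)
  have et : √(j : ℝ) ^ 2 = j := Real.sq_sqrt (by positivity)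
  have eN : √(N : ℝ) ^ 2 = N := Real.sq_sqrt (by positivity)
  have eq : √((i - k : ℕ) : ℝ) ^ 2 = i - k := by
    rw [Real.sq_sqrt (by positivity), Nat.cast_sub hk]
  have hshape := add_sq_le_div_add_div ha0 hb0 hab √(i : ℝ) √(j : ℝ)
  rw [es, et] at hshape
  have h1a : 1 / a ≤ ε * N := by
    refine le_trans ?_ hN'
    rw [div_le_div_iff₀ ha0 h0]; linarith
  have h1a0 : 0 < 1 / a := by positivity
  have h1b0 : 0 < 1 / b := by positivity
  have hra : (1 : ℝ) / a = 1 + b / a := by field_simp; linarith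
  -- The term k b/a is the mean excess of the axis over a bulk row; it is what has to be bounded.
  have hka : (k : ℝ) / a = k * (1 + b / a) := by rw [← hra]; ring
  simp only [add_div] at hG hS
  unfold shape at hL ⊢
  -- The errors in `hG`, `hS` and `hL` add up to 4εN; E = 5εN leaves room.
  have hloss := exit_loss (s := √(i : ℝ)) (t := √(j : ℝ)) (q := √((i - k : ℕ) : ℝ))
    (d := ε * √(N : ℝ)) (r := b / a) (E := 5 * ε * N) hq0 hqs (by positivity) (by positivity)
    (by field_simp; linarith) (by
      rw [es, eq, sub_sub_cancel, ← hka]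
      linarith) (by positivity)
  rw [es, eq, sub_sub_cancel] at hloss
  have hbound : 4 * (5 * ε * N + 2 * (ε * √(N : ℝ)) * √(i : ℝ)) *
      (√(i : ℝ) * (√(j : ℝ) + ε * √(N : ℝ))) ≤ (8 * √ε * N) ^ 2 := by
    calc _ ≤ 4 * (5 * ε * N + 2 * (ε * √(N : ℝ)) * √(N : ℝ)) *
          (√(N : ℝ) * (√(N : ℝ) + 1 * √(N : ℝ))) := by gcongr
      _ = 8 * ε * (5 * N + 2 * √(N : ℝ) ^ 2) * √(N : ℝ) ^ 2 := by ring
      _ = 56 * ε * N ^ 2 := by rw [eN]; ring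
      _ ≤ 64 * ε * N ^ 2 := by gcongr; norm_num
      _ = 64 * √ε ^ 2 * N ^ 2 := by rw [Real.sq_sqrt h0.le]
      _ = _ := by ring
  -- Thus k b/a ≤ 8√ε N. The remaining errors are multiples of εN ≤ √ε N, and 13 covers the total.
  have hlin := le_of_sq_le_sq (hloss.trans hbound) (by positivity)
  have hε : ε * N ≤ √ε * N := by
    gcongr
    exact Real.le_sqrt_of_sq_le (by nlinarith)
  linarith

theorem sum_add_lpp_le_up (η : ℕ → ℕ → ℝ) (k i j : ℕ) :
    ∑ t ∈ Finset.range k, η 0 t + lpp (fun a b => η a (k + b)) i j ≤ lpp η i (k + j) := by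
  rw [← lpp_transpose η, ← lpp_transpose (fun a b => η a (k + b))]
  exact sum_add_lpp_le (fun a b => η b a) k j i

theorem shape_comm (i j : ℕ) : shape i j = shape j i := by
  unfold shape
  rw [add_comm]

/-- The lower tail of last-passage times, uniformly in the endpoints. -/
theorem exists_lpp_lower_tail (hind : iIndepFun w P)
    (hlaw : ∀ z, HasLaw (w z) (expMeasure 1) P) {ε : ℝ} (h0 : 0 < ε) (h1 : ε ≤ 1) :
    ∃ κ > 0, ∃ N₀ : ℕ, ∀ N ≥ N₀, ∀ u : ℤ × ℤ, ∀ i < N, ∀ j < N,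
      P.real {ω | lpp (shiftEnv (fun z => w z ω) u) i j ≤ shape i j - ε * N} ≤
        10 * N * Real.exp (-(κ * N)) := by
  obtain ⟨δ, hδ0, hδ1, hδ⟩ : ∃ δ : ℝ, 0 < δ ∧ δ ≤ 1 ∧ 13 * √δ < ε := by
    refine ⟨(ε / 14) ^ 2, by positivity, by nlinarith, ?_⟩
    rw [Real.sqrt_sq (by positivity)]
    linarith
  have hα0 : 0 < δ / 4 := by positivity
  obtain ⟨κ₁, hκ₁, N₁, hN₁⟩ := exists_lpp_upper_tail hind hlaw hδ0 hδ1
  obtain ⟨κ, hκ, hκ1, hκ2, hκ3⟩ : ∃ κ > 0, κ ≤ κ₁ ∧ κ ≤ (δ * (δ / 4)) ^ 2 / 4 ∧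
      κ ≤ δ ^ 2 / 4 := by
    refine ⟨min κ₁ ((δ * (δ / 4)) ^ 2 / 4), by positivity, min_le_left _ _, min_le_right _ _,
      (min_le_right _ _).trans ?_⟩
    have : δ * (δ / 4) ≤ δ := by nlinarith
    gcongr
  refine ⟨κ, hκ, max N₁ (⌈4 / δ ^ 2⌉₊ + 1), fun N hN u i hi j hj => ?_⟩
  have hN1 : N₁ ≤ N := (le_max_left _ _).trans hN
  have hN2 : ⌈4 / δ ^ 2⌉₊ + 1 ≤ N := (le_max_right _ _).trans hN
  have hN0 : 0 < N := by omega
  have hNr : (0 : ℝ) < N := by exact_mod_cast hN0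
  have hN3 : 4 / δ ^ 2 ≤ N := (Nat.le_ceil _).trans (by exact_mod_cast (by omega))
  have hN4 : 4 / δ ≤ δ * N := by
    rw [div_le_iff₀ (by positivity)] at hN3 ⊢
    linarith
  obtain ⟨a, b, ha, hb, hab, -, hr⟩ := exists_rates hδ0 hδ1 hN0 hi.le hj.le
  have he : ∀ κ', κ ≤ κ' → Real.exp (-(κ' * N)) ≤ Real.exp (-(κ * N)) := fun κ' h => by gcongr
  have hδα : δ * (δ / 4) ≤ 1 := by nlinarith
  -- Bad events: A, a small stationary time; for each exit index k, B a heavy axis, C a large bulk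
  -- time after the exit, D a light bulk row or column. Subscripts 1 and 2 refer to the horizontal
  -- and vertical axis.
  let W : Ω → ℤ × ℤ → ℝ := fun ω z => w z ω
  let A : Set Ω := {ω | lpp (statEnv (W ω) u a b) (i + 1) (j + 1) ≤
    ((i + 1 : ℕ) : ℝ) / a + ((j + 1 : ℕ) : ℝ) / b - 2 * δ * N}
  let B₁ : ℕ → Set Ω := fun k => {ω | ((k + 1 : ℕ) : ℝ) / a + δ * N ≤
    ∑ t ∈ Finset.range (k + 1), statEnv (W ω) u a b (t + 1) 0}
  let B₂ : ℕ → Set Ω := fun k => {ω | ((k + 1 : ℕ) : ℝ) / b + δ * N ≤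
    ∑ t ∈ Finset.range (k + 1), statEnv (W ω) u a b 0 (t + 1)}
  let C₁ : ℕ → Set Ω := fun k => {ω | shape (i - k) j + δ * N ≤
    lpp (shiftEnv (W ω) (u + ((k : ℤ), 0))) (i - k) j}
  let C₂ : ℕ → Set Ω := fun k => {ω | shape i (j - k) + δ * N ≤
    lpp (shiftEnv (W ω) (u + (0, (k : ℤ)))) i (j - k)}
  let D₁ : ℕ → Set Ω := fun k => {ω | ∑ t ∈ Finset.range k, shiftEnv (W ω) u t 0 ≤ k - δ * N}
  let D₂ : ℕ → Set Ω := fun k => {ω | ∑ t ∈ Finset.range k, shiftEnv (W ω) u 0 t ≤ k - δ * N}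
  let F : ℕ → Set Ω := fun k => (B₁ k ∪ (C₁ k ∪ D₁ k)) ∪ (B₂ k ∪ (C₂ k ∪ D₂ k))
  have hsub : {ω | lpp (shiftEnv (W ω) u) i j ≤ shape i j - ε * N} ⊆
      A ∪ ⋃ k ∈ Finset.range N, F k := by
    intro ω hω
    by_contra hcon
    simp only [Set.mem_union, Set.mem_iUnion, Finset.mem_range, not_or, not_exists, A, B₁, B₂,
      C₁, C₂, D₁, D₂, F, Set.mem_ofPred_eq, not_le] at hcon
    obtain ⟨hA, hF⟩ := hcon
    change lpp (shiftEnv (W ω) u) i j ≤ shape i j - ε * N at hω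
    have hfin : shape i j - 13 * √δ * N ≤ lpp (shiftEnv (W ω) u) i j → False := by
      intro h
      have : 13 * √δ * N < ε * N := by gcongr
      linarith
    push_cast at hA
    rcases lpp_exit (η := statEnv (W ω) u a b) rfl i j with ⟨k, hk, hle⟩ | ⟨k, hk, hle⟩
    · obtain ⟨⟨hB, hC, hD⟩, -⟩ := hF k (by omega)
      have hL : (fun a' b' => statEnv (W ω) u a b (k + a' + 1) (b' + 1)) =
          shiftEnv (W ω) (u + ((k : ℤ), 0)) := by
        funext a' b'
        simp [statEnv, shiftEnv, add_assoc]
      have hL' : (fun a' b' => shiftEnv (W ω) u (k + a') b') =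
          shiftEnv (W ω) (u + ((k : ℤ), 0)) := by
        funext a' b'
        simp [shiftEnv, add_assoc]
      have hsup := sum_add_lpp_le (shiftEnv (W ω) u) k (i - k) j
      rw [hL', Nat.add_sub_cancel' hk] at hsup
      rw [hL] at hle
      push_cast at hB
      exact hfin (exit_lower_bound hδ0 hδ1 hN0 hk hi.le hj.le ha hb hab hr hN4 hA.le hle hB.le
        hC.le hD.le hsup)
    · obtain ⟨-, hB, hC, hD⟩ := hF k (by omega)
      have hL : (fun a' b' => statEnv (W ω) u a b (a' + 1) (k + b' + 1)) =
          shiftEnv (W ω) (u + (0, (k : ℤ))) := by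
        funext a' b'
        simp [statEnv, shiftEnv, add_assoc]
      have hL' : (fun a' b' => shiftEnv (W ω) u a' (k + b')) =
          shiftEnv (W ω) (u + (0, (k : ℤ))) := by
        funext a' b'
        simp [shiftEnv, add_assoc]
      have hsup := sum_add_lpp_le_up (shiftEnv (W ω) u) k i (j - k)
      rw [hL', Nat.add_sub_cancel' hk] at hsup
      rw [hL] at hle
      -- The vertical exit is the horizontal one with i, j and a, b exchanged.
      rw [shape_comm] at hC
      rw [shape_comm] at hfin
      push_cast at hB
      rw [add_comm (((i : ℝ) + 1) / a)] at hA
      exact hfin (exit_lower_bound hδ0 hδ1 hN0 hk hj.le hi.le hb ha (by linarith) hr.symm hN4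
        hA.le hle hB.le hC.le hD.le hsup)
  have hAle : P.real A ≤ 2 * Real.exp (-(κ * N)) :=
    (lpp_statEnv_lower hind hlaw u hα0 ha hb hab (Nat.succ_le_of_lt hi) (Nat.succ_le_of_lt hj)
      hδ0.le hδα).trans (by gcongr)
  -- For each axis, B, C and D contribute 1 + 2 + 1.
  have hFle : ∀ k ∈ Finset.range N, P.real (F k) ≤ 8 * Real.exp (-(κ * N)) := by
    intro k hk
    have hk' : k < N := Finset.mem_range.1 hk
    have b1 : P.real (B₁ k) ≤ Real.exp (-(κ * N)) :=
      (statEnv_row_upper hind hlaw u (b := b) hα0 ha (Nat.succ_le_of_lt hk') hδ0.le hδα).trans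
        (he _ hκ2)
    have b2 : P.real (B₂ k) ≤ Real.exp (-(κ * N)) :=
      (statEnv_col_upper hind hlaw u (a := a) hα0 hb (Nat.succ_le_of_lt hk') hδ0.le hδα).trans
        (he _ hκ2)
    have c1 : P.real (C₁ k) ≤ 2 * Real.exp (-(κ * N)) :=
      (hN₁ N hN1 _ _ (by omega) _ hj).trans (by gcongr)
    have c2 : P.real (C₂ k) ≤ 2 * Real.exp (-(κ * N)) :=
      (hN₁ N hN1 _ _ hi _ (by omega)).trans (by gcongr)
    have d1 : P.real (D₁ k) ≤ Real.exp (-(κ * N)) :=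
      (shiftEnv_row_lower hind hlaw u hk'.le hδ0.le hδ1).trans (he _ hκ3)
    have d2 : P.real (D₂ k) ≤ Real.exp (-(κ * N)) :=
      (shiftEnv_col_lower hind hlaw u hk'.le hδ0.le hδ1).trans (he _ hκ3)
    have u1 := measureReal_union_le (μ := P) (B₁ k ∪ (C₁ k ∪ D₁ k)) (B₂ k ∪ (C₂ k ∪ D₂ k))
    have u2 := measureReal_union_le (μ := P) (B₁ k) (C₁ k ∪ D₁ k)
    have u3 := measureReal_union_le (μ := P) (C₁ k) (D₁ k)
    have u4 := measureReal_union_le (μ := P) (B₂ k) (C₂ k ∪ D₂ k)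
    have u5 := measureReal_union_le (μ := P) (C₂ k) (D₂ k)
    linarith
  have hone : (1 : ℝ) ≤ N := by exact_mod_cast hN0
  have hpos := Real.exp_pos (-(κ * N))
  calc P.real {ω | lpp (shiftEnv (W ω) u) i j ≤ shape i j - ε * N}
      ≤ P.real (A ∪ ⋃ k ∈ Finset.range N, F k) := measureReal_mono hsub
    _ ≤ P.real A + P.real (⋃ k ∈ Finset.range N, F k) := measureReal_union_le _ _
    _ ≤ 2 * Real.exp (-(κ * N)) + ∑ k ∈ Finset.range N, P.real (F k) :=
      add_le_add hAle (measureReal_biUnion_finset_le _ _)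
    _ ≤ 2 * Real.exp (-(κ * N)) + ∑ k ∈ Finset.range N, 8 * Real.exp (-(κ * N)) := by
      gcongr with k hk
      exact hFle k hk
    _ ≤ 10 * N * Real.exp (-(κ * N)) := by
      rw [Finset.sum_const, Finset.card_range, nsmul_eq_mul]
      nlinarith

end

/-! ### Paths and geodesics: existence, uniqueness and splitting. -/

section

theorem shiftEnv_zero_zero (w : ℤ × ℤ → ℝ) (x : ℤ × ℤ) : shiftEnv w x 0 0 = w x := by
  unfold shiftEnv
  congr 1
  ext <;> simp

theorem l1_natCast (i j : ℕ) : l1 ((i : ℤ), (j : ℤ)) = i + j := by simp [l1]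

/-- A point of an up-right path and a bound on the weight collected up to that point. -/
theorem exists_sum_path_le {w : ℤ × ℤ → ℝ} {x : ℤ × ℤ} {p : ℕ → ℤ × ℤ} {n : ℕ} (h0 : p 0 = x)
    (hstep : ∀ k < n, p (k + 1) - p k = (1, 0) ∨ p (k + 1) - p k = (0, 1)) :
    ∀ k ≤ n, ∃ i j : ℕ, i + j = k ∧ p k = x + ((i : ℤ), (j : ℤ)) ∧
      ∑ t ∈ Finset.range (k + 1), w (p t) ≤ lpp (shiftEnv w x) i j := by
  intro k
  induction k with
  | zero =>
    intro _
    refine ⟨0, 0, rfl, by simp [h0], by simp [lpp, shiftEnv_zero_zero, h0]⟩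
  | succ k ih =>
    intro hk
    obtain ⟨i, j, hij, hp, hle⟩ := ih (by omega)
    rw [Finset.sum_range_succ]
    rcases hstep k (by omega) with h | h
    · have hp' : p (k + 1) = x + (((i + 1 : ℕ) : ℤ), (j : ℤ)) := by
        rw [sub_eq_iff_eq_add.1 h, hp]
        ext <;> simp
        ring
      refine ⟨i + 1, j, by omega, hp', ?_⟩
      have := lpp_right (shiftEnv w x) i j
      rw [hp']
      unfold shiftEnv at *
      linarith
    · have hp' : p (k + 1) = x + ((i : ℤ), ((j + 1 : ℕ) : ℤ)) := by
        rw [sub_eq_iff_eq_add.1 h, hp]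
        ext <;> simp
        ring
      refine ⟨i, j + 1, by omega, hp', ?_⟩
      have := lpp_up (shiftEnv w x) i j
      rw [hp']
      unfold shiftEnv at *
      linarith

theorem exists_path_append {w : ℤ × ℤ → ℝ} {x y : ℤ × ℤ} {p : ℕ → ℤ × ℤ} {n : ℕ} (h0 : p 0 = x)
    (hstep : ∀ k < n, p (k + 1) - p k = (1, 0) ∨ p (k + 1) - p k = (0, 1))
    (hy : y - p n = (1, 0) ∨ y - p n = (0, 1)) :
    ∃ q : ℕ → ℤ × ℤ, q 0 = x ∧ q (n + 1) = y ∧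
      (∀ k < n + 1, q (k + 1) - q k = (1, 0) ∨ q (k + 1) - q k = (0, 1)) ∧
      ∑ k ∈ Finset.range (n + 1 + 1), w (q k) = ∑ k ∈ Finset.range (n + 1), w (p k) + w y := by
  have hq : ∀ k ≤ n, (if k ≤ n then p k else y) = p k := fun k hk => if_pos hk
  refine ⟨fun k => if k ≤ n then p k else y, by simp [h0], by simp, fun k hk => ?_, ?_⟩
  · rcases Nat.lt_succ_iff_lt_or_eq.1 hk with hk | rfl
    · simp only [hq k hk.le, hq (k + 1) hk]
      exact hstep k hk
    · simpa using hy
  · rw [Finset.sum_range_succ]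
    congr 1
    · refine Finset.sum_congr rfl fun k hk => ?_
      simp only [hq k (by simpa [Nat.lt_succ_iff] using hk)]
    · simp

/-- A maximizing path is built by appending, at each step of the recursion, the endpoint to a path
to the neighbour that attains the maximum. -/
theorem exists_path_sum_eq (w : ℤ × ℤ → ℝ) (x : ℤ × ℤ) (i j : ℕ) :
    ∃ p : ℕ → ℤ × ℤ, p 0 = x ∧ p (i + j) = x + ((i : ℤ), (j : ℤ)) ∧
      (∀ k < i + j, p (k + 1) - p k = (1, 0) ∨ p (k + 1) - p k = (0, 1)) ∧
      ∑ k ∈ Finset.range (i + j + 1), w (p k) = lpp (shiftEnv w x) i j := by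
  have hr : ∀ i j, lpp (shiftEnv w x) (i + 1) j = lpp (shiftEnv w x) i j +
      shiftEnv w x (i + 1) j →
      (∃ p : ℕ → ℤ × ℤ, p 0 = x ∧ p (i + j) = x + ((i : ℤ), (j : ℤ)) ∧
      (∀ k < i + j, p (k + 1) - p k = (1, 0) ∨ p (k + 1) - p k = (0, 1)) ∧
      ∑ k ∈ Finset.range (i + j + 1), w (p k) = lpp (shiftEnv w x) i j) →
      (∃ p : ℕ → ℤ × ℤ, p 0 = x ∧ p (i + 1 + j) = x + (((i + 1 : ℕ) : ℤ), (j : ℤ)) ∧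
      (∀ k < i + 1 + j, p (k + 1) - p k = (1, 0) ∨ p (k + 1) - p k = (0, 1)) ∧
      ∑ k ∈ Finset.range (i + 1 + j + 1), w (p k) = lpp (shiftEnv w x) (i + 1) j) := by
    rintro i j he ⟨p, h0, h1, h2, h3⟩
    obtain ⟨q, q0, q1, q2, q3⟩ := exists_path_append (w := w)
      (y := x + (((i + 1 : ℕ) : ℤ), (j : ℤ))) h0 h2 (by rw [h1]; left; ext <;> simp)
    rw [show i + 1 + j = i + j + 1 by ring]
    exact ⟨q, q0, q1, q2, by rw [q3, h3, he]; rfl⟩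
  have hu : ∀ i j, lpp (shiftEnv w x) i (j + 1) = lpp (shiftEnv w x) i j +
      shiftEnv w x i (j + 1) →
      (∃ p : ℕ → ℤ × ℤ, p 0 = x ∧ p (i + j) = x + ((i : ℤ), (j : ℤ)) ∧
      (∀ k < i + j, p (k + 1) - p k = (1, 0) ∨ p (k + 1) - p k = (0, 1)) ∧
      ∑ k ∈ Finset.range (i + j + 1), w (p k) = lpp (shiftEnv w x) i j) →
      (∃ p : ℕ → ℤ × ℤ, p 0 = x ∧ p (i + (j + 1)) = x + ((i : ℤ), ((j + 1 : ℕ) : ℤ)) ∧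
      (∀ k < i + (j + 1), p (k + 1) - p k = (1, 0) ∨ p (k + 1) - p k = (0, 1)) ∧
      ∑ k ∈ Finset.range (i + (j + 1) + 1), w (p k) = lpp (shiftEnv w x) i (j + 1)) := by
    rintro i j he ⟨p, h0, h1, h2, h3⟩
    obtain ⟨q, q0, q1, q2, q3⟩ := exists_path_append (w := w)
      (y := x + ((i : ℤ), ((j + 1 : ℕ) : ℤ))) h0 h2 (by rw [h1]; right; ext <;> simp)
    rw [← add_assoc]
    exact ⟨q, q0, q1, q2, by rw [q3, h3, he]; rfl⟩
  induction j generalizing i with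
  | zero =>
    induction i with
    | zero => exact ⟨fun _ => x, rfl, by simp, by simp, by simp [lpp, shiftEnv_zero_zero]⟩
    | succ i ih => exact hr i 0 (by rw [lpp]) ih
  | succ j ihj =>
    induction i with
    | zero => exact hu 0 j (by rw [lpp]) (ihj 0)
    | succ i ih =>
      rcases max_choice (lpp (shiftEnv w x) i (j + 1)) (lpp (shiftEnv w x) (i + 1) j) with h | h
      · exact hr i (j + 1) (by rw [lpp.eq_4, h]) ih
      · exact hu (i + 1) j (by rw [lpp.eq_4, h]) (ihj (i + 1))

theorem isUpRightPath_zero_iff {i j : ℕ} {p : ℕ → ℤ × ℤ} :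
    IsUpRightPath 0 ((i : ℤ), (j : ℤ)) p ↔ p 0 = 0 ∧ p (i + j) = ((i : ℤ), (j : ℤ)) ∧
      ∀ k < i + j, p (k + 1) - p k = (1, 0) ∨ p (k + 1) - p k = (0, 1) := by
  unfold IsUpRightPath
  rw [sub_zero, l1_natCast]

theorem pathWeight_zero (w : ℤ × ℤ → ℝ) (i j : ℕ) (p : ℕ → ℤ × ℤ) :
    pathWeight w 0 ((i : ℤ), (j : ℤ)) p = ∑ k ∈ Finset.range (i + j + 1), w (p k) := by
  unfold pathWeight
  rw [sub_zero, l1_natCast]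

theorem lastPassage_zero (w : ℤ × ℤ → ℝ) (i j : ℕ) :
    lastPassage w 0 ((i : ℤ), (j : ℤ)) = ((lpp (shiftEnv w 0) i j : ℝ) : EReal) := by
  refine le_antisymm (iSup₂_le fun p hp => ?_) ?_
  · rw [pathWeight_zero, EReal.coe_le_coe_iff]
    obtain ⟨h0, h1, h2⟩ := isUpRightPath_zero_iff.1 hp
    obtain ⟨i', j', -, hp', hle⟩ := exists_sum_path_le (w := w) h0 h2 (i + j) le_rfl
    rw [h1, zero_add, Prod.mk.injEq, Nat.cast_inj, Nat.cast_inj] at hp'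
    rwa [← hp'.1, ← hp'.2] at hle
  · obtain ⟨p, h0, h1, h2, h3⟩ := exists_path_sum_eq w 0 i j
    rw [zero_add] at h1
    rw [← h3, ← pathWeight_zero w i j p]
    exact le_iSup₂ (f := fun p _ => ((pathWeight w 0 ((i : ℤ), (j : ℤ)) p : ℝ) : EReal)) p
      (isUpRightPath_zero_iff.2 ⟨h0, h1, h2⟩)

theorem isGeodesic_zero_iff {w : ℤ × ℤ → ℝ} {i j : ℕ} {p : ℕ → ℤ × ℤ} :
    IsGeodesic w 0 ((i : ℤ), (j : ℤ)) p ↔ (p 0 = 0 ∧ p (i + j) = ((i : ℤ), (j : ℤ)) ∧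
      ∀ k < i + j, p (k + 1) - p k = (1, 0) ∨ p (k + 1) - p k = (0, 1)) ∧
      ∑ k ∈ Finset.range (i + j + 1), w (p k) = lpp (shiftEnv w 0) i j := by
  unfold IsGeodesic
  rw [isUpRightPath_zero_iff, lastPassage_zero, EReal.coe_eq_coe_iff, pathWeight_zero]

theorem exists_natCast_eq {x : ℤ × ℤ} (hx : 0 ≤ x) : ∃ i j : ℕ, x = ((i : ℤ), (j : ℤ)) := by
  obtain ⟨a, b⟩ := x
  obtain ⟨ha, hb⟩ := Prod.le_def.1 hx
  lift a to ℕ using ha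
  lift b to ℕ using hb
  exact ⟨a, b, rfl⟩

theorem exists_geodesic (w : ℤ × ℤ → ℝ) (i j : ℕ) : ∃ p, IsGeodesic w 0 ((i : ℤ), (j : ℤ)) p := by
  obtain ⟨p, h0, h1, h2, h3⟩ := exists_path_sum_eq w 0 i j
  rw [zero_add] at h1
  exact ⟨p, isGeodesic_zero_iff.2 ⟨⟨h0, h1, h2⟩, h3⟩⟩

/-- Geodesics are unique in an environment in which different finite sets have different
weights. -/
theorem geodesic_unique {w : ℤ × ℤ → ℝ}
    (hw : ∀ A B : Finset (ℤ × ℤ), A ≠ B → ∑ z ∈ A, w z ≠ ∑ z ∈ B, w z) {i j : ℕ}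
    {p q : ℕ → ℤ × ℤ} (hp : IsGeodesic w 0 ((i : ℤ), (j : ℤ)) p)
    (hq : IsGeodesic w 0 ((i : ℤ), (j : ℤ)) q) : ∀ k ≤ i + j, q k = p k := by
  have key : ∀ r : ℕ → ℤ × ℤ, IsGeodesic w 0 ((i : ℤ), (j : ℤ)) r →
      (∀ k ≤ i + j, (r k).1 + (r k).2 = k) ∧
      ∑ z ∈ (Finset.range (i + j + 1)).image r, w z = lpp (shiftEnv w 0) i j := by
    intro r hr
    obtain ⟨⟨h0, -, h2⟩, h3⟩ := isGeodesic_zero_iff.1 hr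
    -- A path meets each antidiagonal once, so it is injective and can be recovered from its image.
    have hlev : ∀ k ≤ i + j, (r k).1 + (r k).2 = k := by
      intro k hk
      obtain ⟨a, b, hab, hrk, -⟩ := exists_sum_path_le (w := w) h0 h2 k hk
      rw [hrk, ← hab]
      simp
    refine ⟨hlev, ?_⟩
    rw [Finset.sum_image, h3]
    intro k hk l hl hkl
    have h4 := hlev k (by simpa [Nat.lt_succ_iff] using hk)
    have h5 := hlev l (by simpa [Nat.lt_succ_iff] using hl)
    rw [hkl] at h4
    exact_mod_cast h4.symm.trans h5
  obtain ⟨p1, p2⟩ := key p hp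
  obtain ⟨q1, q2⟩ := key q hq
  have himage : (Finset.range (i + j + 1)).image p = (Finset.range (i + j + 1)).image q := by
    by_contra h
    exact hw _ _ h (p2.trans q2.symm)
  intro k hk
  have hmem : q k ∈ (Finset.range (i + j + 1)).image p := by
    rw [himage]
    exact Finset.mem_image_of_mem q (Finset.mem_range.2 (by omega))
  obtain ⟨l, hl, hlk⟩ := Finset.mem_image.1 hmem
  have h4 := p1 l (by simpa [Nat.lt_succ_iff] using hl)
  have h5 := q1 k hk
  rw [hlk] at h4
  have : l = k := by exact_mod_cast h4.symm.trans h5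
  rw [← hlk, this]

/-- Fubini: given the value y of Y, the independent atomless X equals -y with probability 0. -/
theorem ae_add_ne_zero {Ω : Type*} [MeasurableSpace Ω] {P : Measure Ω} [IsProbabilityMeasure P]
    {X Y : Ω → ℝ} {μ : Measure ℝ} [NullSingletonClass μ] (hX : HasLaw X μ P)
    (hY : AEMeasurable Y P) (h : IndepFun Y X P) : ∀ᵐ ω ∂P, X ω + Y ω ≠ 0 := by
  have hμ : IsProbabilityMeasure μ := hX.isProbabilityMeasure_iff.1 inferInstance
  have hmap := (indepFun_iff_map_prod_eq_prod_map_map hY hX.aemeasurable).1 h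
  rw [hX.map_eq] at hmap
  have hs : MeasurableSet {z : ℝ × ℝ | z.2 + z.1 = 0} :=
    measurableSet_eq_fun (by fun_prop) (by fun_prop)
  have h0 : ((P.map Y).prod μ) {z : ℝ × ℝ | z.2 + z.1 = 0} = 0 := by
    rw [Measure.measure_prod_null hs]
    refine ae_of_all _ fun y => ?_
    have : Prod.mk y ⁻¹' {z : ℝ × ℝ | z.2 + z.1 = 0} = {-y} := by
      ext x
      simp [add_eq_zero_iff_eq_neg]
    simp only [this, measure_singleton, Pi.zero_apply]
  rw [← hmap, Measure.map_apply_of_aemeasurable (hY.prodMk hX.aemeasurable) hs] at h0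
  exact measure_eq_zero_iff_ae_notMem.1 h0

/-- There are countably many pairs of finite sets. For a site in just one of them, its weight is
atomless and independent of the rest of the difference of the sums. -/
theorem ae_sum_ne_sum {Ω : Type*} [MeasurableSpace Ω] {P : Measure Ω} [IsProbabilityMeasure P]
    {w : ℤ × ℤ → Ω → ℝ} (hind : iIndepFun w P) (hlaw : ∀ z, HasLaw (w z) (expMeasure 1) P) :
    ∀ᵐ ω ∂P, ∀ A B : Finset (ℤ × ℤ), A ≠ B → ∑ z ∈ A, w z ω ≠ ∑ z ∈ B, w z ω := by
  have key : ∀ A B : Finset (ℤ × ℤ), ∀ z ∈ A, z ∉ B →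
      ∀ᵐ ω ∂P, ∑ z ∈ A, w z ω ≠ ∑ z ∈ B, w z ω := by
    intro A B z hzA hzB
    let c : ℤ × ℤ → ℝ := fun v => (if v ∈ A then 1 else 0) - (if v ∈ B then 1 else 0)
    have hc : c z = 1 := by simp [c, hzA, hzB]
    have hi : iIndepFun (fun v ω => c v * w v ω) P :=
      hind.comp (fun v x => c v * x) fun _ => by fun_prop
    have hm : ∀ v, AEMeasurable (fun ω => c v * w v ω) P := fun v =>
      (hlaw v).aemeasurable.const_mul _
    have h1 := hi.indepFun_finsetSum_of_notMem₀ hm (Finset.notMem_erase z (A ∪ B))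
    have hX : HasLaw (fun ω => c z * w z ω) (expMeasure 1) P := by
      simpa [hc] using hlaw z
    have := nullSingletonClass_expMeasure 1
    have h2 := ae_add_ne_zero hX (Finset.aemeasurable_sum _ fun v _ => hm v) h1
    filter_upwards [h2] with ω hω he
    apply hω
    rw [Finset.sum_apply, Finset.add_sum_erase (A ∪ B) (fun v => c v * w v ω)
      (Finset.mem_union_left _ hzA)]
    simp only [c, sub_mul, Finset.sum_sub_distrib, ite_mul, one_mul, zero_mul,
      Finset.sum_ite_mem, Finset.union_inter_cancel_left, Finset.union_inter_cancel_right]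
    linarith
  rw [ae_all_iff]
  intro A
  rw [ae_all_iff]
  intro B
  rw [ae_all_iff]
  intro hAB
  by_cases h : A ⊆ B
  · obtain ⟨z, hzB, hzA⟩ := Finset.exists_of_ssubset (h.ssubset_of_ne hAB)
    filter_upwards [key B A z hzB hzA] with ω hω using hω.symm
  · obtain ⟨z, hzA, hzB⟩ := Finset.not_subset.1 h
    exact key A B z hzA hzB

/-- A geodesic from the origin splits at each of its points. -/
theorem geodesic_split {w : ℤ × ℤ → ℝ} (hw : ∀ z, 0 ≤ w z) {i j : ℕ} {p : ℕ → ℤ × ℤ}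
    (hp : IsGeodesic w 0 ((i : ℤ), (j : ℤ)) p) {k : ℕ} (hk : k ≤ i + j) :
    ∃ i₁ j₁ i₂ j₂ : ℕ, p k = ((i₁ : ℤ), (j₁ : ℤ)) ∧ i₁ + j₁ = k ∧ i₁ + i₂ = i ∧ j₁ + j₂ = j ∧
      lpp (shiftEnv w 0) i j ≤ lpp (shiftEnv w 0) i₁ j₁ +
        lpp (shiftEnv w ((i₁ : ℤ), (j₁ : ℤ))) i₂ j₂ := by
  obtain ⟨⟨h0, h1, h2⟩, h3⟩ := isGeodesic_zero_iff.1 hp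
  obtain ⟨i₁, j₁, e1, e2, e3⟩ := exists_sum_path_le (w := w) h0 h2 k hk
  rw [zero_add] at e2
  obtain ⟨i₂, j₂, f1, f2, f3⟩ := exists_sum_path_le (w := w) (x := ((i₁ : ℤ), (j₁ : ℤ)))
    (p := fun t => p (k + t)) (n := i + j - k) (by simpa using e2)
    (fun t ht => h2 (k + t) (by omega)) (i + j - k) le_rfl
  have f4 : k + (i + j - k) = i + j := by omega
  simp only [f4, h1, Prod.mk_add_mk, Prod.mk.injEq] at f2
  refine ⟨i₁, j₁, i₂, j₂, e2, e1, by omega, by omega, ?_⟩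
  rw [← h3]
  have hsum : ∑ t ∈ Finset.range (i + j + 1), w (p t) =
      ∑ t ∈ Finset.range k, w (p t) + ∑ t ∈ Finset.range (i + j - k + 1), w (p (k + t)) := by
    rw [← Finset.sum_range_add]
    congr 2
    omega
  -- The two last-passage times both count the weight of `p k`, which is harmless because it is
  -- nonnegative.
  rw [Finset.sum_range_succ] at e3
  linarith [hw (p k)]

end

/-! ### Strict concavity of the shape and localization of geodesics. -/

section

/-- Strict concavity of the limit shape. -/
theorem cross_sq_le_shape_gap (i₁ j₁ i₂ j₂ : ℕ) :
    8 * ((i₁ : ℝ) * j₂ - j₁ * i₂) ^ 2 ≤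
      (shape (i₁ + i₂) (j₁ + j₂) - shape i₁ j₁ - shape i₂ j₂) *
        ((i₁ : ℝ) + i₂ + j₁ + j₂) ^ 3 := by
  unfold shape
  push_cast
  have ha := Real.sqrt_nonneg (i₁ : ℝ)
  have hb := Real.sqrt_nonneg (j₁ : ℝ)
  have hc := Real.sqrt_nonneg (i₂ : ℝ)
  have hd := Real.sqrt_nonneg (j₂ : ℝ)
  have he := Real.sqrt_nonneg ((i₁ : ℝ) + i₂)
  have hf := Real.sqrt_nonneg ((j₁ : ℝ) + j₂)
  have sa : √(i₁ : ℝ) ^ 2 = i₁ := Real.sq_sqrt (by positivity)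
  have sb : √(j₁ : ℝ) ^ 2 = j₁ := Real.sq_sqrt (by positivity)
  have sc : √(i₂ : ℝ) ^ 2 = i₂ := Real.sq_sqrt (by positivity)
  have sd : √(j₂ : ℝ) ^ 2 = j₂ := Real.sq_sqrt (by positivity)
  have se : √((i₁ : ℝ) + i₂) ^ 2 = i₁ + i₂ := Real.sq_sqrt (by positivity)
  have sf : √((j₁ : ℝ) + j₂) ^ 2 = j₁ + j₂ := Real.sq_sqrt (by positivity)
  generalize √((i₁ : ℝ) + i₂) = e at *
  generalize √((j₁ : ℝ) + j₂) = f at *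
  generalize √(i₁ : ℝ) = a at *
  generalize √(j₁ : ℝ) = b at *
  generalize √(i₂ : ℝ) = c at *
  generalize √(j₂ : ℝ) = d at *
  rw [← sa, ← sc] at se
  rw [← sb, ← sd] at sf
  rw [← sa, ← sb, ← sc, ← sd]
  have hM : a ^ 2 + c ^ 2 + b ^ 2 + d ^ 2 = e ^ 2 + f ^ 2 := by rw [se, sf]; ring
  have hX : e * f ≤ (e ^ 2 + f ^ 2) / 2 := by nlinarith [sq_nonneg (e - f)]
  have hX0 : 0 ≤ e * f := mul_nonneg he hf
  have hX2 : (e * f) ^ 2 = (a ^ 2 + c ^ 2) * (b ^ 2 + d ^ 2) := by rw [mul_pow, se, sf]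
  have hY : a * b + c * d ≤ e * f := by
    refine le_of_sq_le_sq ?_ hX0
    rw [hX2]
    nlinarith [sq_nonneg (a * d - b * c)]
  have hZ : a * d + b * c ≤ e * f := by
    refine le_of_sq_le_sq ?_ hX0
    rw [hX2]
    nlinarith [sq_nonneg (a * b - c * d)]
  have hY0 : 0 ≤ a * b + c * d := by positivity
  have hZ0 : 0 ≤ a * d + b * c := by positivity
  -- Lagrange's identity. The first factor is half the concavity gap, and (ad - bc)(ad + bc) is the
  -- cross product of the two displacements.
  have h1 : (a * d - b * c) ^ 2 = (e * f - (a * b + c * d)) * (e * f + (a * b + c * d)) := by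
    have : (e * f - (a * b + c * d)) * (e * f + (a * b + c * d)) =
        (e * f) ^ 2 - (a * b + c * d) ^ 2 := by ring
    rw [this, hX2]
    ring
  have hD0 : 0 ≤ e * f - (a * b + c * d) := by linarith
  have hgap : (e + f) ^ 2 - (a + b) ^ 2 - (c + d) ^ 2 = 2 * (e * f - (a * b + c * d)) := by
    linear_combination se + sf
  rw [hgap, hM]
  calc 8 * (a ^ 2 * d ^ 2 - b ^ 2 * c ^ 2) ^ 2
      = 8 * ((a * d - b * c) ^ 2 * (a * d + b * c) ^ 2) := by ring
    _ = 8 * ((e * f - (a * b + c * d)) * (e * f + (a * b + c * d)) * (a * d + b * c) ^ 2) := by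
      rw [h1]
    _ ≤ 8 * ((e * f - (a * b + c * d)) * ((e ^ 2 + f ^ 2) / 2 + (e ^ 2 + f ^ 2) / 2) *
        ((e ^ 2 + f ^ 2) / 2) ^ 2) := by
      gcongr
      · exact hY.trans hX
      · exact hZ.trans hX
    _ = _ := by ring

/-- The point and its counterpart on the segment lie on the same antidiagonal, so the two coordinate
differences are opposite. Each is the cross product over the length, up to sign. -/
theorem pointDeviation_zero {i₁ j₁ i₂ j₂ : ℕ} (hM : 0 < i₁ + i₂ + (j₁ + j₂)) {p : ℕ → ℤ × ℤ}
    (hp : p (i₁ + j₁) = ((i₁ : ℤ), (j₁ : ℤ))) :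
    pointDeviation 0 (((i₁ + i₂ : ℕ) : ℤ), ((j₁ + j₂ : ℕ) : ℤ)) p (i₁ + j₁) =
      2 * |(i₁ : ℝ) * j₂ - j₁ * i₂| / ((i₁ : ℝ) + i₂ + j₁ + j₂) := by
  have hM' : (0 : ℝ) < (i₁ : ℝ) + i₂ + j₁ + j₂ := by
    have : (0 : ℝ) < ((i₁ + i₂ + (j₁ + j₂) : ℕ) : ℝ) := by exact_mod_cast hM
    push_cast at this
    linarith
  have hM'' : (0 : ℝ) < (i₁ : ℝ) + i₂ + (j₁ + j₂) := by linarith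
  unfold pointDeviation
  rw [sub_zero, l1_natCast, hp]
  simp only [Prod.fst_zero, Prod.snd_zero, Int.cast_zero, mul_zero, sub_zero, Int.cast_natCast]
  push_cast
  have e1 : (i₁ : ℝ) - (i₁ + j₁) / (i₁ + i₂ + (j₁ + j₂)) * (i₁ + i₂) =
      ((i₁ : ℝ) * j₂ - j₁ * i₂) / (i₁ + i₂ + j₁ + j₂) := by
    field_simp
    ring
  have e2 : (j₁ : ℝ) - (i₁ + j₁) / (i₁ + i₂ + (j₁ + j₂)) * (j₁ + j₂) =
      -(((i₁ : ℝ) * j₂ - j₁ * i₂) / (i₁ + i₂ + j₁ + j₂)) := by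
    field_simp
    ring
  rw [e1, e2, abs_neg, abs_div, abs_of_pos hM']
  ring

theorem pointDeviation_nonneg (x y : ℤ × ℤ) (p : ℕ → ℤ × ℤ) (i : ℕ) :
    0 ≤ pointDeviation x y p i := by
  unfold pointDeviation
  positivity

theorem deviation_nonneg (x y : ℤ × ℤ) (p : ℕ → ℤ × ℤ) : 0 ≤ deviation x y p := by
  unfold deviation
  exact (pointDeviation_nonneg x y p 0).trans
    (Finset.le_sup' (pointDeviation x y p) (Finset.mem_range.2 (Nat.succ_pos _)))

/-- If the last-passage times are close to the limit shape, then geodesics are close to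
segments. -/
theorem deviation_lt {w : ℤ × ℤ → ℝ} (hw : ∀ z, 0 ≤ w z) {ε δ : ℝ} (hε : 0 < ε) (hδ : 0 < δ)
    (hδε : 3 * δ ≤ ε ^ 2) {M : ℕ} (hM : 0 < M)
    (hlow : ∀ i < M + 1, ∀ j < M + 1,
      shape i j - δ * (M + 1 : ℕ) < lpp (shiftEnv w 0) i j)
    (hup : ∀ k < M + 1, ∀ l < M + 1, ∀ i < M + 1, ∀ j < M + 1,
      lpp (shiftEnv w ((k : ℤ), (l : ℤ))) i j < shape i j + δ * (M + 1 : ℕ))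
    {i j : ℕ} (hij : i + j = M) {p : ℕ → ℤ × ℤ}
    (hp : IsGeodesic w 0 ((i : ℤ), (j : ℤ)) p) :
    deviation 0 ((i : ℤ), (j : ℤ)) p < ε * M := by
  unfold deviation
  rw [Finset.sup'_lt_iff]
  intro k hk
  rw [sub_zero, l1_natCast, Finset.mem_range, Nat.lt_succ_iff] at hk
  obtain ⟨i₁, j₁, i₂, j₂, hpk, rfl, rfl, rfl, hle⟩ := geodesic_split hw hp hk
  rw [pointDeviation_zero (by omega) hpk]
  have h1 := hlow (i₁ + i₂) (by omega) (j₁ + j₂) (by omega)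
  have h2 := hup 0 (by omega) 0 (by omega) i₁ (by omega) j₁ (by omega)
  have h3 := hup i₁ (by omega) j₁ (by omega) i₂ (by omega) j₂ (by omega)
  have h0 : (((0 : ℕ) : ℤ), ((0 : ℕ) : ℤ)) = (0 : ℤ × ℤ) := by simp
  rw [h0] at h2
  have hMr : (1 : ℝ) ≤ M := by exact_mod_cast hM
  have hMe : (i₁ : ℝ) + i₂ + j₁ + j₂ = M := by
    rw [← hij]
    push_cast
    ring
  have hgap := cross_sq_le_shape_gap i₁ j₁ i₂ j₂
  rw [hMe] at hgap ⊢
  push_cast at h1 h2 h3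
  -- Three errors δ(M + 1), with M + 1 ≤ 2M. For the cross product X this yields 8X² < 6δM⁴, hence
  -- (2X)² < 3δM⁴ ≤ (εM²)².
  have hD : shape (i₁ + i₂) (j₁ + j₂) - shape i₁ j₁ - shape i₂ j₂ < 6 * δ * M := by
    nlinarith
  rw [div_lt_iff₀ (by linarith)]
  refine lt_of_pow_lt_pow_left₀ 2 (by positivity) ?_
  rw [mul_pow, sq_abs]
  have h4 : (shape (i₁ + i₂) (j₁ + j₂) - shape i₁ j₁ - shape i₂ j₂) * (M : ℝ) ^ 3 <
      6 * δ * M * M ^ 3 := by gcongr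
  have h5 : 3 * δ * (M : ℝ) ^ 4 ≤ ε ^ 2 * M ^ 4 := by gcongr
  nlinarith

variable {Ω : Type*} [MeasurableSpace Ω] {P : Measure Ω} [IsProbabilityMeasure P]
  {w : ℤ × ℤ → Ω → ℝ}

/-- The probability that some last-passage time in a large box is far from the limit shape. -/
theorem tendsto_bad_event (hind : iIndepFun w P)
    (hlaw : ∀ z, HasLaw (w z) (expMeasure 1) P) {δ : ℝ} (h0 : 0 < δ) (h1 : δ ≤ 1) :
    Tendsto (fun N : ℕ => P.real {ω | ¬ ((∀ i < N, ∀ j < N,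
      shape i j - δ * N < lpp (shiftEnv (fun z => w z ω) 0) i j) ∧
      ∀ k < N, ∀ l < N, ∀ i < N, ∀ j < N,
        lpp (shiftEnv (fun z => w z ω) ((k : ℤ), (l : ℤ))) i j < shape i j + δ * N)})
      atTop (𝓝 0) := by
  obtain ⟨κ₁, hκ₁, N₁, hN₁⟩ := exists_lpp_upper_tail hind hlaw h0 h1
  obtain ⟨κ₂, hκ₂, N₂, hN₂⟩ := exists_lpp_lower_tail hind hlaw h0 h1
  have hκ : 0 < min κ₁ κ₂ := lt_min hκ₁ hκ₂
  -- The union bound has N² lower-tail events of cost 10N and N⁴ upper-tail events of cost 2. Upper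
  -- tails are needed from every starting point, since the second piece of a geodesic starts
  -- anywhere in the box.
  have hlim : Tendsto (fun N : ℕ => 12 * ((N : ℝ) ^ (4 : ℝ) *
      Real.exp (-(min κ₁ κ₂) * (N : ℝ)))) atTop (𝓝 0) := by
    have := (tendsto_rpow_mul_exp_neg_mul_atTop_nhds_zero 4 _ hκ).comp
      tendsto_natCast_atTop_atTop
    simpa using this.const_mul 12
  refine squeeze_zero' (Eventually.of_forall fun _ => measureReal_nonneg) ?_ hlim
  filter_upwards [eventually_ge_atTop N₁, eventually_ge_atTop N₂, eventually_ge_atTop 1]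
    with N hN1 hN2 hN3
  let L : ℕ × ℕ → Set Ω := fun z =>
    {ω | lpp (shiftEnv (fun z => w z ω) 0) z.1 z.2 ≤ shape z.1 z.2 - δ * N}
  let U : (ℕ × ℕ) × (ℕ × ℕ) → Set Ω := fun z =>
    {ω | shape z.2.1 z.2.2 + δ * N ≤
      lpp (shiftEnv (fun z => w z ω) ((z.1.1 : ℤ), (z.1.2 : ℤ))) z.2.1 z.2.2}
  let R : Finset (ℕ × ℕ) := Finset.range N ×ˢ Finset.range N
  have hR : ∀ z ∈ R, z.1 < N ∧ z.2 < N := by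
    intro z hz
    simpa [R] using hz
  have hcard : R.card = N ^ 2 := by simp [R, sq]
  set e := Real.exp (-(min κ₁ κ₂) * (N : ℝ)) with he
  have hL : ∀ z ∈ R, P.real (L z) ≤ 10 * N * e := by
    intro z hz
    refine (hN₂ N hN2 0 z.1 (hR z hz).1 z.2 (hR z hz).2).trans ?_
    rw [he, neg_mul]
    gcongr
    exact min_le_right _ _
  have hU : ∀ z ∈ R ×ˢ R, P.real (U z) ≤ 2 * e := by
    intro z hz
    obtain ⟨-, hz⟩ := Finset.mem_product.1 hz
    refine (hN₁ N hN1 _ z.2.1 (hR _ hz).1 z.2.2 (hR _ hz).2).trans ?_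
    rw [he, neg_mul]
    gcongr
    exact min_le_left _ _
  have hNr : (1 : ℝ) ≤ N := by exact_mod_cast hN3
  have he0 : 0 < e := Real.exp_pos _
  calc P.real _ ≤ P.real ((⋃ z ∈ R, L z) ∪ ⋃ z ∈ R ×ˢ R, U z) := by
        refine measureReal_mono fun ω hω => ?_
        by_contra hcon
        apply hω
        simp only [Set.mem_union, Set.mem_iUnion, not_or, not_exists, L, U, Set.mem_ofPred_eq,
          not_le] at hcon
        refine ⟨fun i hi j hj => hcon.1 (i, j) (by simp [R, hi, hj]),
          fun k hk l hl i hi j hj => hcon.2 ((k, l), (i, j)) (by simp [R, hi, hj, hk, hl])⟩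
    _ ≤ ∑ z ∈ R, P.real (L z) + ∑ z ∈ R ×ˢ R, P.real (U z) :=
      (measureReal_union_le _ _).trans
        (add_le_add (measureReal_biUnion_finset_le _ _) (measureReal_biUnion_finset_le _ _))
    _ ≤ ∑ z ∈ R, 10 * N * e + ∑ z ∈ R ×ˢ R, 2 * e :=
      add_le_add (Finset.sum_le_sum hL) (Finset.sum_le_sum hU)
    _ = 10 * N ^ 3 * e + 2 * N ^ 4 * e := by
      simp only [Finset.sum_const, Finset.card_product, hcard, nsmul_eq_mul]
      push_cast
      ring
    _ ≤ 10 * N ^ 4 * e + 2 * N ^ 4 * e := by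
      gcongr
      norm_num
    _ = 12 * ((N : ℝ) ^ (4 : ℝ) * e) := by
      rw [show (4 : ℝ) = ((4 : ℕ) : ℝ) by norm_num, Real.rpow_natCast]
      ring

/-- Almost surely, there is a unique geodesic from the origin to each point of the quadrant. -/
theorem ae_existsUnique_geodesic (hind : iIndepFun w P)
    (hlaw : ∀ z, HasLaw (w z) (expMeasure 1) P) :
    ∀ᵐ ω ∂P, ∀ x : ℤ × ℤ, 0 ≤ x → ∃ p, IsGeodesic (fun z => w z ω) 0 x p ∧
      ∀ q, IsGeodesic (fun z => w z ω) 0 x q → ∀ i ≤ l1 x, q i = p i := by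
  filter_upwards [ae_sum_ne_sum hind hlaw] with ω hω x hx
  obtain ⟨i, j, rfl⟩ := exists_natCast_eq hx
  obtain ⟨p, hp⟩ := exists_geodesic (fun z => w z ω) i j
  refine ⟨p, hp, fun q hq => ?_⟩
  rw [l1_natCast]
  exact geodesic_unique hω hp hq

/-- The maximal normalized deviation of the geodesics to a level tends to `0` in probability. -/
theorem tendstoInMeasure_deviation (hind : iIndepFun w P)
    (hlaw : ∀ z, HasLaw (w z) (expMeasure 1) P) {geo : ℤ × ℤ → Ω → ℕ → ℤ × ℤ}
    (hgeo : ∀ x : ℤ × ℤ, 0 ≤ x → ∀ᵐ ω ∂P, IsGeodesic (fun z => w z ω) 0 x (geo x ω)) :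
    TendstoInMeasure P
      (fun (M : ℕ) (ω : Ω) => (level M).sup' (level_nonempty M)
        (fun x => deviation 0 x (geo x ω) / (l1 x : ℝ))) atTop (fun _ => (0 : ℝ)) := by
  rw [tendstoInMeasure_iff_measureReal_dist]
  intro ε hε
  obtain ⟨δ, hδ0, hδ1, hδε⟩ : ∃ δ : ℝ, 0 < δ ∧ δ ≤ 1 ∧ 3 * δ ≤ ε ^ 2 :=
    ⟨min 1 (ε ^ 2 / 3), by positivity, min_le_left _ _, by
      linarith [min_le_right 1 (ε ^ 2 / 3)]⟩
  -- The box of side N = M + 1 contains all coordinates up to M.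
  have hlim := (tendsto_add_atTop_iff_nat 1).2 (tendsto_bad_event hind hlaw hδ0 hδ1)
  have hgeo' : ∀ᵐ ω ∂P, ∀ x : ℤ × ℤ, 0 ≤ x →
      IsGeodesic (fun z => w z ω) 0 x (geo x ω) :=
    ae_all_iff.2 fun x => by
      by_cases hx : 0 ≤ x
      · filter_upwards [hgeo x hx] with ω h _ using h
      · exact ae_of_all _ fun ω h => absurd h hx
  refine squeeze_zero' (Eventually.of_forall fun _ => measureReal_nonneg) ?_ hlim
  filter_upwards [eventually_ge_atTop 1] with M hM
  refine ENNReal.toReal_mono (measure_ne_top _ _) (measure_mono_ae ?_)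
  filter_upwards [hgeo', ae_forall_nonneg hlaw] with ω hω hnn h hgood
  obtain ⟨hlow, hup⟩ := hgood
  refine absurd h (not_le.2 ?_)
  have hMr : (0 : ℝ) < M := by exact_mod_cast hM
  rw [Real.dist_eq, sub_zero, abs_of_nonneg]
  · rw [Finset.sup'_lt_iff]
    intro x hx
    obtain ⟨hx0, hxM⟩ := mem_level.1 hx
    have hgx := hω x hx0
    obtain ⟨i, j, rfl⟩ := exists_natCast_eq hx0
    rw [l1_natCast] at hxM ⊢
    rw [hxM, div_lt_iff₀ hMr]
    exact deviation_lt hnn hε hδ0 hδε hM hlow hup hxM hgx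
  · obtain ⟨x, hx⟩ := level_nonempty M
    exact (div_nonneg (deviation_nonneg _ _ _) (Nat.cast_nonneg _)).trans
      (Finset.le_sup' (fun x => deviation 0 x (geo x ω) / (l1 x : ℝ)) hx)

end

end CornerGrowth

theorem theoremt {Ω : Type*} [MeasurableSpace Ω] (P : Measure Ω) [IsProbabilityMeasure P]
    (w : ℤ × ℤ → Ω → ℝ)
    (hindep : iIndepFun w P)
    (hlaw : ∀ z, HasLaw (w z) (expMeasure 1) P) :
    -- almost surely, for every `x ≥ 0` the geodesic from `0` to `x` exists and is unique
    (∀ᵐ ω ∂P, ∀ x : ℤ × ℤ, 0 ≤ x →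
      ∃ p, CornerGrowth.IsGeodesic (fun z => w z ω) 0 x p ∧
        ∀ q, CornerGrowth.IsGeodesic (fun z => w z ω) 0 x q →
          ∀ i ≤ CornerGrowth.l1 x, q i = p i) ∧
    -- the maximal normalized deviation of the geodesics tends to `0` in probability
    ∀ geo : ℤ × ℤ → Ω → ℕ → ℤ × ℤ,
      (∀ x : ℤ × ℤ, 0 ≤ x → ∀ᵐ ω ∂P,
        CornerGrowth.IsGeodesic (fun z => w z ω) 0 x (geo x ω)) →
      TendstoInMeasure P
        (fun (M : ℕ) (ω : Ω) => (CornerGrowth.level M).sup' (CornerGrowth.level_nonempty M)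
          (fun x => CornerGrowth.deviation 0 x (geo x ω) / (CornerGrowth.l1 x : ℝ)))
        atTop (fun _ => (0 : ℝ)) :=
  ⟨CornerGrowth.ae_existsUnique_geodesic hindep hlaw,
    fun _ hgeo => CornerGrowth.tendstoInMeasure_deviation hindep hlaw hgeo⟩
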